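/- Let $N\ge 1$ be an integer, and put $a_{\min}=\frac{1}{N+1}$ and $a_0^*=\frac{3N+1}{(N+1)(2N+1)}$. Let $\tilde a_0$ be the unique root in $(a_{\min},1)$ of the equation $$(2N+1)^{2N+1}a^{N+1}\big((N+1)a-1\big)^N=N^N .$$ For $a_{\min}<a<1$ let $b$ be the number with $(N+1)a-Nb=1$, let $x_i=\frac{i}{2N+1}$ for $0\le i\le 2N+1$, and let $y_{2j}=j(a-b)$, $y_{2j+1}=(j+1)a-jb$ for $0\le j\le N$. Define functions on $[0,1]$ by $f_0(x)=x$ and, for $n\ge 1$ and $0\le i\le 2N$, $$f_n(x)=y_i+(y_{i+1}-y_i)\,f_{n-1}\big((2N+1)(x-x_i)\big),\qquad x_i\le x\le x_{i+1}.$$ The sequence $(f_n)$ converges uniformly on $[0,1]$; let $F_{N,a}$ be its limit, and let $\mathcal D_0(a)=\{x\in(0,1): F_{N,a}'(x)=0\}$. Put $$\phi_N(a)=\frac{\log((2N+1)a)}{\log(Na)-\log((N+1)a-1)},\qquad a_{\min}<a<1,$$ $$h_N(p)=-\frac{1}{\log(2N+1)}\Big[p\log\frac pN+(1-p)\log\frac{1-p}{N+1}\Big],\qquad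 0<p<1,$$ and let $\dim_H$ denote Hausdorff dimension. Then: (i) If $\tilde a_0\le a<a_0^*$, then $\dim_H\mathcal D_0(a)=h_N(\phi_N(a))$. (ii) If $a_{\min}<a\le\tilde a_0$, then $\dim_H\big((0,1)\setminus\mathcal D_0(a)\big)=h_N(\phi_N(a))$. (iii) The function $a\mapsto h_N(\phi_N(a))$ is concave on $(a_{\min},a_0^*)$; the point $\tilde a_0$ lies in this interval, and there the function takes its maximum value, which is $1$. Its limits as $a\downarrow a_{\min}$ and as $a\uparrow a_0^*$ are $\frac{\log(N+1)}{\log(2N+1)}$ and $\frac{\log N}{\log(2N+1)}$, respectively. -/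

import Mathlib

open Set Filter Topology

noncomputable section

namespace SelfAffine

/-- The number `b` determined by `(N+1)a - Nb = 1`. -/
def bParam (N : ℕ) (a : ℝ) : ℝ := (((N : ℝ) + 1) * a - 1) / N

/-- The ordinates `y_{2j} = j(a-b)`, `y_{2j+1} = (j+1)a - jb` of the interpolation points. -/
def yNode (N : ℕ) (a : ℝ) (i : ℕ) : ℝ :=
  if Even i then ((i / 2 : ℕ) : ℝ) * (a - bParam N a)
  else (((i / 2 : ℕ) : ℝ) + 1) * a - ((i / 2 : ℕ) : ℝ) * bParam N a

/-- The abscissae `x_i = i/(2N+1)` of the interpolation points. -/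
def xNode (N : ℕ) (i : ℕ) : ℝ := (i : ℝ) / (2 * (N : ℝ) + 1)

/-- For `x ∈ [0,1]`, the largest `i ∈ {0,…,2N}` with `x_i ≤ x`. -/
def cell (N : ℕ) (x : ℝ) : ℕ := min ⌊(2 * (N : ℝ) + 1) * x⌋₊ (2 * N)

/-- The approximants: `f_0(x) = x` and
`f_{n+1}(x) = y_i + (y_{i+1} - y_i) f_n((2N+1)(x - x_i))` for `x_i ≤ x ≤ x_{i+1}`. Only their
values on `[0,1]` matter. -/
def approx (N : ℕ) (a : ℝ) : ℕ → ℝ → ℝ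
  | 0, x => x
  | n + 1, x =>
      yNode N a (cell N x) + (yNode N a (cell N x + 1) - yNode N a (cell N x)) *
        approx N a n ((2 * (N : ℝ) + 1) * (x - xNode N (cell N x)))

/-- The limit function `F_{N,a}`. -/
def F (N : ℕ) (a : ℝ) (x : ℝ) : ℝ := limUnder atTop (fun n => approx N a n x)

/-- The set of points of `(0,1)` at which `F_{N,a}` has derivative zero. -/
def zeroDerivSet (N : ℕ) (a : ℝ) : Set ℝ := {x | x ∈ Ioo (0 : ℝ) 1 ∧ HasDerivAt (F N a) 0 x}

/-- `1/(N+1)`. -/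
def aMin (N : ℕ) : ℝ := 1 / ((N : ℝ) + 1)

/-- `(3N+1)/((N+1)(2N+1))`. -/
def aStar (N : ℕ) : ℝ := (3 * (N : ℝ) + 1) / (((N : ℝ) + 1) * (2 * (N : ℝ) + 1))

/-- `a` is a root in `(1/(N+1), 1)` of `(2N+1)^{2N+1} a^{N+1} ((N+1)a-1)^N = N^N`. -/
def IsThresholdRoot (N : ℕ) (a : ℝ) : Prop :=
  a ∈ Ioo (aMin N) 1 ∧
    (2 * (N : ℝ) + 1) ^ (2 * N + 1) * a ^ (N + 1) * (((N : ℝ) + 1) * a - 1) ^ N = (N : ℝ) ^ N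

/-- The threshold: the root in `(1/(N+1), 1)`, which exists and is unique for `N ≥ 1`
(see `existsUnique_isThresholdRoot` and `aTilde_spec` below). -/
def aTilde (N : ℕ) : ℝ := sInf {a | IsThresholdRoot N a}

/-- The function `φ_N`. -/
def phi (N : ℕ) (a : ℝ) : ℝ :=
  Real.log ((2 * (N : ℝ) + 1) * a) / (Real.log ((N : ℝ) * a) - Real.log (((N : ℝ) + 1) * a - 1))

/-- The function `h_N`. -/
def h (N : ℕ) (p : ℝ) : ℝ :=
  -(1 / Real.log (2 * (N : ℝ) + 1)) *
    (p * Real.log (p / N) + (1 - p) * Real.log ((1 - p) / ((N : ℝ) + 1)))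

/-! The definitions above are meaningful: the next facts check this. -/

theorem bParam_eq {N : ℕ} (hN : 1 ≤ N) (a : ℝ) : ((N : ℝ) + 1) * a - N * bParam N a = 1 := by
  have : (N : ℝ) ≠ 0 := by positivity
  unfold bParam
  field_simp
  ring

theorem yNode_even (N : ℕ) (a : ℝ) (j : ℕ) : yNode N a (2 * j) = j * (a - bParam N a) := by
  simp [yNode]

theorem yNode_odd (N : ℕ) (a : ℝ) (j : ℕ) :
    yNode N a (2 * j + 1) = (j + 1) * a - j * bParam N a := by
  have h1 : ¬ Even (2 * j + 1) := by simp
  have h2 : (2 * j + 1) / 2 = j := by omega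
  simp only [yNode, h1, h2, if_false]

theorem yNode_step (N : ℕ) (a : ℝ) (i : ℕ) :
    yNode N a (i + 1) - yNode N a i = a ∨ yNode N a (i + 1) - yNode N a i = -bParam N a := by
  rcases Nat.even_or_odd' i with ⟨j, rfl | rfl⟩
  · left
    rw [yNode_odd, yNode_even]; ring
  · right
    rw [show 2 * j + 1 + 1 = 2 * (j + 1) by ring, yNode_odd, yNode_even]; push_cast; ring

theorem approx_zero_one {N : ℕ} (hN : 1 ≤ N) (a : ℝ) (n : ℕ) :
    approx N a n 0 = 0 ∧ approx N a n 1 = 1 := by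
  induction n with
  | zero => simp [approx]
  | succ n ih =>
    have c0 : cell N 0 = 0 := by simp [cell]
    have c1 : cell N 1 = 2 * N := by
      have : ⌊(2 * (N : ℝ) + 1) * 1⌋₊ = 2 * N + 1 := by
        rw [mul_one]; exact_mod_cast Nat.floor_natCast (R := ℝ) (2 * N + 1)
      rw [cell, this]; omega
    have e : (2 * (N : ℝ) + 1) * (1 - xNode N (2 * N)) = 1 := by
      unfold xNode; push_cast; field_simp; ring
    have y0 : yNode N a 0 = 0 := by simp [yNode]
    have y1 : yNode N a (2 * N + 1) = 1 := by rw [yNode_odd]; exact bParam_eq hN a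
    constructor
    · simp [approx, c0, y0, xNode, ih.1]
    · simp only [approx, c1, e, ih.2, y1]; ring

/-- The recursion holds on every closed interval `[x_i, x_{i+1}]`. -/
theorem approx_succ {N : ℕ} (hN : 1 ≤ N) (a : ℝ) (n i : ℕ) (hi : i ≤ 2 * N) (x : ℝ)
    (hx : x ∈ Icc (xNode N i) (xNode N (i + 1))) :
    approx N a (n + 1) x = yNode N a i + (yNode N a (i + 1) - yNode N a i) *
      approx N a n ((2 * (N : ℝ) + 1) * (x - xNode N i)) := by
  have hp : (0 : ℝ) < 2 * (N : ℝ) + 1 := by positivity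
  obtain ⟨hl, hr⟩ := hx
  have hl' : (i : ℝ) ≤ (2 * (N : ℝ) + 1) * x := by
    unfold xNode at hl; rw [div_le_iff₀ hp] at hl; linarith
  have key : ∀ k : ℕ, (k : ℝ) ≤ (2 * (N : ℝ) + 1) * x → (2 * (N : ℝ) + 1) * x < k + 1 →
      k ≤ 2 * N → cell N x = k := by
    intro k h1 h2 h3
    have : ⌊(2 * (N : ℝ) + 1) * x⌋₊ = k :=
      (Nat.floor_eq_iff (le_trans (Nat.cast_nonneg k) h1)).2 ⟨h1, h2⟩
    simp [cell, this, h3]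
  rcases lt_or_eq_of_le hr with hr | rfl
  · have hr' : (2 * (N : ℝ) + 1) * x < i + 1 := by
      unfold xNode at hr; rw [lt_div_iff₀ hp] at hr; push_cast at hr; linarith
    simp only [approx, key i hl' hr' hi]
  · have e1 : (2 * (N : ℝ) + 1) * (xNode N (i + 1) - xNode N i) = 1 := by
      unfold xNode; push_cast; field_simp; ring
    have e2 : (2 * (N : ℝ) + 1) * xNode N (i + 1) = ((i + 1 : ℕ) : ℝ) := by
      unfold xNode; field_simp
    rcases lt_or_eq_of_le hi with hi | rfl
    · have c : cell N (xNode N (i + 1)) = i + 1 := by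
        apply key
        · rw [e2]
        · rw [e2]; linarith
        · omega
      simp only [approx, c, e1, sub_self, mul_zero, (approx_zero_one hN a n).1,
        (approx_zero_one hN a n).2]
      ring
    · have c : cell N (xNode N (2 * N + 1)) = 2 * N := by
        have : ⌊(2 * (N : ℝ) + 1) * xNode N (2 * N + 1)⌋₊ = 2 * N + 1 := by
          rw [e2]; exact Nat.floor_natCast _
        simp [cell, this]
      simp only [approx, c]

theorem cell_mem {N : ℕ} {x : ℝ} (hx : x ∈ Icc (0 : ℝ) 1) :
    (2 * (N : ℝ) + 1) * (x - xNode N (cell N x)) ∈ Icc (0 : ℝ) 1 := by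
  have hp : (0 : ℝ) < 2 * (N : ℝ) + 1 := by positivity
  have e : (2 * (N : ℝ) + 1) * (x - xNode N (cell N x)) =
      (2 * (N : ℝ) + 1) * x - (cell N x : ℝ) := by
    unfold xNode; field_simp
  have h0 : 0 ≤ (2 * (N : ℝ) + 1) * x := mul_nonneg hp.le hx.1
  rw [e]
  constructor
  · have h1 : (cell N x : ℝ) ≤ (⌊(2 * (N : ℝ) + 1) * x⌋₊ : ℝ) := by
      exact Nat.cast_le.2 (min_le_left _ _)
    linarith [Nat.floor_le h0]
  · rcases le_total ⌊(2 * (N : ℝ) + 1) * x⌋₊ (2 * N) with h | h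
    · have : cell N x = ⌊(2 * (N : ℝ) + 1) * x⌋₊ := min_eq_left h
      rw [this]
      linarith [Nat.lt_floor_add_one ((2 * (N : ℝ) + 1) * x)]
    · have : cell N x = 2 * N := min_eq_right h
      rw [this]; push_cast
      nlinarith [hx.2]

/-- The approximants converge uniformly on `[0,1]` to `F_{N,a}`. -/
theorem tendstoUniformlyOn_approx {N : ℕ} (hN : 1 ≤ N) {a : ℝ} (ha : a ∈ Ioo (aMin N) 1) :
    TendstoUniformlyOn (approx N a) (F N a) atTop (Icc 0 1) := by
  obtain ⟨h1, h2⟩ := ha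
  have hNp : (0 : ℝ) < N := by exact_mod_cast hN
  have ha0 : 0 < a := lt_trans (by unfold aMin; positivity) h1
  have hb0 : 0 < bParam N a := by
    unfold aMin at h1; rw [div_lt_iff₀ (by positivity)] at h1
    unfold bParam; apply div_pos _ hNp; linarith
  have hba : bParam N a < a := by
    unfold bParam; rw [div_lt_iff₀ hNp]; linarith
  have hs : ∀ i, |yNode N a (i + 1) - yNode N a i| ≤ a := by
    intro i
    rcases yNode_step N a i with h | h <;> rw [h]
    · rw [abs_of_pos ha0]
    · rw [abs_neg, abs_of_pos hb0]; exact hba.le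
  set C : ℝ := ∑ i ∈ Finset.range (2 * N + 1), |yNode N a i| + 2 with hC
  have hstep : ∀ n, ∀ x ∈ Icc (0 : ℝ) 1,
      |approx N a n x - approx N a (n + 1) x| ≤ C * a ^ n := by
    intro n
    induction n with
    | zero =>
      intro x hx
      have ht := cell_mem (N := N) hx
      have hy : |yNode N a (cell N x)| ≤ ∑ i ∈ Finset.range (2 * N + 1), |yNode N a i| :=
        Finset.single_le_sum (f := fun i => |yNode N a i|) (fun _ _ => abs_nonneg _)
          (Finset.mem_range.2 (Nat.lt_succ_of_le (min_le_right _ _)))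
      simp only [approx, pow_zero, mul_one]
      set t := (2 * (N : ℝ) + 1) * (x - xNode N (cell N x))
      have hm : |(yNode N a (cell N x + 1) - yNode N a (cell N x)) * t| ≤ 1 := by
        rw [abs_mul]
        have := hs (cell N x)
        have ht' : |t| ≤ 1 := by rw [abs_of_nonneg ht.1]; exact ht.2
        nlinarith [abs_nonneg t, abs_nonneg (yNode N a (cell N x + 1) - yNode N a (cell N x))]
      have hxa : |x| ≤ 1 := by rw [abs_of_nonneg hx.1]; exact hx.2
      calc |x - (yNode N a (cell N x) + (yNode N a (cell N x + 1) - yNode N a (cell N x)) * t)|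
          ≤ |x| + |yNode N a (cell N x) +
              (yNode N a (cell N x + 1) - yNode N a (cell N x)) * t| := abs_sub _ _
        _ ≤ |x| + (|yNode N a (cell N x)| +
              |(yNode N a (cell N x + 1) - yNode N a (cell N x)) * t|) := by
            gcongr; exact abs_add_le _ _
        _ ≤ C := by rw [hC]; linarith
    | succ n ih =>
      intro x hx
      have ht := ih _ (cell_mem (N := N) hx)
      rw [approx, approx, add_sub_add_left_eq_sub, ← mul_sub, abs_mul, pow_succ]
      calc _ ≤ a * (C * a ^ n) := by
            gcongr
            exact hs _
        _ = C * (a ^ n * a) := by ring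
  have hlim : ∀ x ∈ Icc (0 : ℝ) 1, Tendsto (fun n => approx N a n x) atTop (𝓝 (F N a x)) := by
    intro x hx
    have hc : CauchySeq (fun n => approx N a n x) :=
      cauchySeq_of_le_geometric a C h2 (fun n => hstep n x hx)
    exact tendsto_nhds_limUnder (cauchySeq_tendsto_of_complete hc)
  rw [Metric.tendstoUniformlyOn_iff]
  intro ε hε
  have hg : Tendsto (fun n : ℕ => C * a ^ n / (1 - a)) atTop (𝓝 0) := by
    have := ((tendsto_pow_atTop_nhds_zero_of_lt_one ha0.le h2).const_mul C).div_const (1 - a)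
    simpa using this
  filter_upwards [hg.eventually (gt_mem_nhds hε)] with n hn x hx
  rw [dist_comm]
  exact lt_of_le_of_lt
    (dist_le_of_le_geometric_of_tendsto a C h2 (fun n => hstep n x hx) (hlim x hx) n) hn

theorem existsUnique_isThresholdRoot {N : ℕ} (hN : 1 ≤ N) : ∃! a, IsThresholdRoot N a := by
  have hNp : (0 : ℝ) < N := by exact_mod_cast hN
  set g : ℝ → ℝ := fun a =>
    (2 * (N : ℝ) + 1) ^ (2 * N + 1) * a ^ (N + 1) * (((N : ℝ) + 1) * a - 1) ^ N with hg
  have hm0 : 0 < aMin N := by unfold aMin; positivity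
  have hm1 : aMin N < 1 := by
    unfold aMin; rw [div_lt_one (by positivity)]; linarith
  have hz : ((N : ℝ) + 1) * aMin N - 1 = 0 := by unfold aMin; field_simp; ring
  have hmono : StrictMonoOn g (Ici (aMin N)) := by
    intro s hs t ht hst
    have hs' : aMin N ≤ s := hs
    have hs0 : 0 < s := lt_of_lt_of_le hm0 hs'
    have h0 : 0 ≤ ((N : ℝ) + 1) * s - 1 := by
      rw [← hz]; gcongr
    have h1 : ((N : ℝ) + 1) * s - 1 < ((N : ℝ) + 1) * t - 1 := by gcongr
    have h2 : (((N : ℝ) + 1) * s - 1) ^ N < (((N : ℝ) + 1) * t - 1) ^ N :=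
      pow_lt_pow_left₀ h1 h0 (by omega)
    have h3 : s ^ (N + 1) ≤ t ^ (N + 1) := pow_le_pow_left₀ hs0.le hst.le _
    have h4 : 0 < s ^ (N + 1) := by positivity
    have h5 : 0 ≤ (((N : ℝ) + 1) * s - 1) ^ N := by positivity
    simp only [hg, mul_assoc]
    gcongr 1
    · exact mul_lt_mul' h3 h2 h5 (lt_of_lt_of_le h4 h3)
  have hcont : ContinuousOn g (Icc (aMin N) 1) := by
    simp only [hg]; fun_prop
  have hga : g (aMin N) < (N : ℝ) ^ N := by
    simp only [hg, hz, zero_pow (by omega : N ≠ 0), mul_zero]; positivity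
  have hgb : (N : ℝ) ^ N < g 1 := by
    simp only [hg, one_pow, mul_one, add_sub_cancel_right]
    have : (1 : ℝ) < (2 * (N : ℝ) + 1) ^ (2 * N + 1) :=
      one_lt_pow₀ (by linarith) (by omega)
    nlinarith [pow_pos hNp N]
  obtain ⟨a, ha, hga'⟩ := intermediate_value_Ioo hm1.le hcont ⟨hga, hgb⟩
  refine ⟨a, ⟨ha, hga'⟩, ?_⟩
  rintro c ⟨hc, hgc⟩
  exact hmono.injOn hc.1.le ha.1.le ((show g c = (N : ℝ) ^ N from hgc).trans hga'.symm)

theorem aTilde_spec {N : ℕ} (hN : 1 ≤ N) :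
    IsThresholdRoot N (aTilde N) ∧ ∀ a, IsThresholdRoot N a → a = aTilde N := by
  obtain ⟨a, ha, hu⟩ := existsUnique_isThresholdRoot hN
  have hset : {c | IsThresholdRoot N c} = {a} := by
    ext c; exact ⟨fun hc => hu c hc, fun hc => by rw [mem_singleton_iff.1 hc]; exact ha⟩
  have : aTilde N = a := by rw [aTilde, hset, csInf_singleton]
  rw [this]
  exact ⟨ha, hu⟩

end SelfAffine

end

/-!
Write `r = 2N+1` and let `b` be given by `(N+1)a - Nb = 1`. On the `k`-th interval of level `n` the
graph of `F` is an affine copy of the whole graph (`F_affine`), with a chord of slope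
`± (r a)^n (b/a)^o`, where `o` is the number of odd base `r` digits of `k`. Passing to an
adjacent interval changes `o` by at most one (`oddDigits_succ`), because a carry only exchanges the even
digits `2N` and `0` apart from one further step. Hence `F'(x) = 0` exactly when the slopes of the
chords over the intervals containing `x` tend to `0` (`mem_zeroDerivSet_iff`), and up to the
critical case this means that the frequency of odd digits of `x` exceeds `phi N a`.

It remains to find the dimension of sets given by digit frequencies. For the upper bounds, the
generating function `∑ t^o = (N t + N + 1)^n` gives a Chernoff bound on the number of intervals of
level `n` (`card_le_rpow`); with `t` chosen as the tilt at `p` the exponential rate is the entropy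
`h N p`, and summing over the tail of the levels bounds the Hausdorff measure (`dimH_limsup_le`).
For the lower bounds, prescribe `j` odd digits in every block of `K` digits. The resulting Cantor set is
the image of `[0,1)` under an order preserving substitution of digits whose inverse is Hölder
(`le_dimH_image_substPoint`), and its dimension tends to `h N p` when `j / K` tends to `p` and
`K` to infinity, since the `j`-th term of the expansion of `(j + (K - j))^K` is the largest
(`pow_self_le_choose`).

Concavity of `h ∘ phi` is a second derivative computation. The sign of the derivative of `h` is
that of `-Λ`, where `Λ` is the logarithm of the tilt at `phi`. With `D = log (a/b)`, the bound
`-Λ ≤ D` suffices to the left of the threshold, where `Λ ≤ 0` (`second_deriv_bound_left`, `neg_log_tilt_le`);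
to the right, where `Λ ≥ 0`, it suffices that `D ≤ 2` and `a/b ≥ 2` (`second_deriv_bound_right`,
`logRatio_le_two`). In both cases the claim then reduces to a completed square.
-/

open scoped ENNReal NNReal

namespace SelfAffine

/-! ### Counting odd digits in base `2N+1` -/

/-- The number of odd digits of `k` in base `2N+1`. Leading zeros are even, so the count does not
depend on the number of digits with which `k` is written. -/
def oddDigits (N k : ℕ) : ℕ := (Nat.digits (2 * N + 1) k).countP (fun d => d % 2 = 1)

@[simp] theorem oddDigits_zero (N : ℕ) : oddDigits N 0 = 0 := by simp [oddDigits]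

theorem oddDigits_mul_add {N : ℕ} (hN : 1 ≤ N) (q : ℕ) {i : ℕ} (hi : i < 2 * N + 1) :
    oddDigits N ((2 * N + 1) * q + i) = oddDigits N q + i % 2 := by
  by_cases h : i = 0 ∧ q = 0
  · simp [h.1, h.2]
  · rw [oddDigits, add_comm _ i, Nat.digits_add _ (by omega) i q hi (by tauto), List.countP_cons,
      oddDigits]
    congr 1
    rcases Nat.mod_two_eq_zero_or_one i with h | h <;> simp [h]

theorem oddDigits_pow_mul_add {N : ℕ} (hN : 1 ≤ N) (K q : ℕ) {w : ℕ} (hw : w < (2 * N + 1) ^ K) :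
    oddDigits N ((2 * N + 1) ^ K * q + w) = oddDigits N q + oddDigits N w := by
  induction K generalizing w with
  | zero =>
    have : w = 0 := by simpa using hw
    simp [this]
  | succ K ih =>
    have h1 : w / (2 * N + 1) < (2 * N + 1) ^ K := by
      rw [Nat.div_lt_iff_lt_mul (by omega)]; rwa [pow_succ] at hw
    have h2 : w % (2 * N + 1) < 2 * N + 1 := Nat.mod_lt _ (by omega)
    have h3 : (2 * N + 1) ^ (K + 1) * q + w =
        (2 * N + 1) * ((2 * N + 1) ^ K * q + w / (2 * N + 1)) + w % (2 * N + 1) := by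
      conv_lhs => rw [← Nat.div_add_mod w (2 * N + 1)]
      ring
    have h4 := oddDigits_mul_add hN (w / (2 * N + 1)) h2
    rw [Nat.div_add_mod] at h4
    rw [h3, oddDigits_mul_add hN _ h2, ih h1, h4]
    ring

/-- Adjacent intervals of the same level have slopes of comparable size: a carry turns trailing
digits `2N` into `0`, both even, and changes one further digit by one. -/
theorem oddDigits_succ {N : ℕ} (hN : 1 ≤ N) (k : ℕ) :
    oddDigits N (k + 1) ≤ oddDigits N k + 1 ∧ oddDigits N k ≤ oddDigits N (k + 1) + 1 := by
  induction k using Nat.strong_induction_on with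
  | _ k ih =>
    have hi : k % (2 * N + 1) < 2 * N + 1 := Nat.mod_lt _ (by omega)
    have e := Nat.div_add_mod k (2 * N + 1)
    set q := k / (2 * N + 1) with hq
    set i := k % (2 * N + 1)
    have h1 := oddDigits_mul_add hN q hi
    rcases Nat.lt_or_ge (i + 1) (2 * N + 1) with h | h
    · have h2 := oddDigits_mul_add hN q h
      rw [← add_assoc] at h2
      rw [e] at h1 h2
      omega
    · have hi' : i = 2 * N := by omega
      have h2 := oddDigits_mul_add hN (q + 1) (i := 0) (by omega)
      have h3 : (2 * N + 1) * (q + 1) + 0 = k + 1 := by rw [← e, hi']; ring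
      have hqk : q < k := by
        have : 1 * q ≤ (2 * N + 1) * q := Nat.mul_le_mul_right _ (by omega)
        omega
      have h4 := ih q hqk
      rw [h3] at h2
      rw [e] at h1
      omega

theorem sum_range_mul_eq {M : Type*} [AddCommMonoid M] (f : ℕ → M) (m n : ℕ) :
    ∑ k ∈ Finset.range (n * m), f k =
      ∑ q ∈ Finset.range m, ∑ i ∈ Finset.range n, f (n * q + i) := by
  induction m with
  | zero => simp
  | succ m ih => rw [Nat.mul_succ, Finset.sum_range_add, ih, Finset.sum_range_succ]

theorem sum_pow_mod_two {R : Type*} [CommSemiring R] (t : R) (N : ℕ) :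
    ∑ i ∈ Finset.range (2 * N + 1), t ^ (i % 2) = (N : R) * t + ((N : R) + 1) := by
  induction N with
  | zero => simp
  | succ N ih =>
    have h1 : (2 * N + 1) % 2 = 1 := by omega
    have h2 : (2 * N + 1 + 1) % 2 = 0 := by omega
    rw [show 2 * (N + 1) + 1 = 2 * N + 1 + 1 + 1 by ring, Finset.sum_range_succ,
      Finset.sum_range_succ, ih, h1, h2]
    push_cast; ring

/-- The generating function of the number of odd digits. -/
theorem sum_pow_oddDigits {R : Type*} [CommSemiring R] {N : ℕ} (hN : 1 ≤ N) (t : R) (n : ℕ) :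
    ∑ k ∈ Finset.range ((2 * N + 1) ^ n), t ^ oddDigits N k =
      ((N : R) * t + ((N : R) + 1)) ^ n := by
  induction n with
  | zero => simp
  | succ n ih =>
    rw [pow_succ', sum_range_mul_eq, pow_succ, ← ih, Finset.sum_mul]
    refine Finset.sum_congr rfl fun q _ => ?_
    rw [← sum_pow_mod_two, Finset.mul_sum]
    refine Finset.sum_congr rfl fun i hi => ?_
    rw [oddDigits_mul_add hN q (Finset.mem_range.1 hi), pow_add]

theorem card_oddDigits_eq {N : ℕ} (hN : 1 ≤ N) (K j : ℕ) (hj : j ≤ K) :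
    ((Finset.range ((2 * N + 1) ^ K)).filter (fun k => oddDigits N k = j)).card =
      K.choose j * N ^ j * (N + 1) ^ (K - j) := by
  have h := congrArg (fun p => Polynomial.coeff p j)
    (sum_pow_oddDigits hN (Polynomial.X : Polynomial ℕ) K)
  simp only [Polynomial.finsetSum_coeff, Polynomial.coeff_X_pow] at h
  have h2 : ∀ i, ((N : Polynomial ℕ) * Polynomial.X) ^ i * ((N : Polynomial ℕ) + 1) ^ (K - i) *
      (K.choose i : Polynomial ℕ) =
      Polynomial.C (K.choose i * N ^ i * (N + 1) ^ (K - i)) * Polynomial.X ^ i := by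
    intro i
    simp only [map_mul, map_pow, map_add, map_one]
    simp only [← Polynomial.C_eq_natCast, Nat.cast_id]
    ring
  rw [add_pow ((N : Polynomial ℕ) * _), Polynomial.finsetSum_coeff] at h
  simp only [h2, Polynomial.coeff_C_mul, Polynomial.coeff_X_pow] at h
  rw [Finset.card_filter]
  simp only [eq_comm (a := j)] at h
  rw [h]
  simp only [mul_ite, mul_one, mul_zero]
  rw [Finset.sum_ite_eq' , if_pos (Finset.mem_range.2 (by omega))]

/-- Chernoff's bound for the number of integers with at least `q n` (or, for `t ≤ 1`, at most
`q n`) odd digits among `n`. -/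
theorem card_mul_rpow_le {N : ℕ} (hN : 1 ≤ N) {t : ℝ} (ht : 0 < t) (q : ℝ) (n : ℕ)
    (A : Finset ℕ) (hA : ∀ k ∈ A, k < (2 * N + 1) ^ n ∧
      t ^ (q * n) ≤ t ^ oddDigits N k) :
    (A.card : ℝ) * t ^ (q * n) ≤ (N * t + (N + 1)) ^ n := by
  rw [← sum_pow_oddDigits hN t n, ← nsmul_eq_mul]
  refine (Finset.card_nsmul_le_sum A (fun k => t ^ oddDigits N k) _ fun k hk => (hA k hk).2).trans
    (Finset.sum_le_sum_of_subset_of_nonneg ?_ fun _ _ _ => by positivity)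
  exact fun k hk => Finset.mem_range.2 (hA k hk).1

/-! ### Self-affinity of the limit function -/

section Parameters

variable {N : ℕ} {a : ℝ}

theorem pos_of_mem (ha : a ∈ Ioo (aMin N) 1) : 0 < a :=
  lt_trans (by unfold aMin; positivity) ha.1

theorem bParam_pos (hN : 1 ≤ N) (ha : a ∈ Ioo (aMin N) 1) : 0 < bParam N a := by
  have hNp : (0 : ℝ) < N := by exact_mod_cast hN
  have h1 := ha.1
  unfold aMin at h1
  rw [div_lt_iff₀ (by positivity)] at h1
  exact div_pos (by linarith) hNp

theorem bParam_lt (hN : 1 ≤ N) (ha : a ∈ Ioo (aMin N) 1) : bParam N a < a := by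
  have hNp : (0 : ℝ) < N := by exact_mod_cast hN
  unfold bParam
  rw [div_lt_iff₀ hNp]
  linarith [ha.2]

theorem one_lt_expansion (hN : 1 ≤ N) (ha : a ∈ Ioo (aMin N) 1) : 1 < (2 * (N : ℝ) + 1) * a := by
  have hNp : (0 : ℝ) < N := by exact_mod_cast hN
  have h1 := ha.1
  have h0 := pos_of_mem ha
  unfold aMin at h1
  rw [div_lt_iff₀ (by positivity)] at h1
  nlinarith

end Parameters

variable {N : ℕ} {a : ℝ}

theorem yNode_sub (N : ℕ) (ha : a ≠ 0) (i : ℕ) :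
    yNode N a (i + 1) - yNode N a i = a * (-(bParam N a / a)) ^ (i % 2) := by
  rcases Nat.even_or_odd' i with ⟨j, rfl | rfl⟩
  · rw [yNode_odd, yNode_even, Nat.mul_mod_right]; ring
  · rw [show 2 * j + 1 + 1 = 2 * (j + 1) by ring, yNode_odd, yNode_even,
      show (2 * j + 1) % 2 = 1 by omega]
    push_cast; field_simp; ring

theorem yNode_mem (hN : 1 ≤ N) (ha : a ∈ Ioo (aMin N) 1) {i : ℕ} (hi : i ≤ 2 * N + 1) :
    yNode N a i ∈ Icc (0 : ℝ) 1 := by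
  have h0 := pos_of_mem ha
  have hb := bParam_pos hN ha
  have hba := bParam_lt hN ha
  have he := bParam_eq hN a
  have key : ∀ j : ℕ, j ≤ N → 0 ≤ (j : ℝ) * (a - bParam N a) ∧
      (j : ℝ) * (a - bParam N a) ≤ 1 - a := by
    intro j hj
    have hj' : (j : ℝ) ≤ N := by exact_mod_cast hj
    constructor
    · exact mul_nonneg j.cast_nonneg (by linarith)
    · calc (j : ℝ) * (a - bParam N a) ≤ N * (a - bParam N a) := by gcongr
        _ = 1 - a := by linarith
  rcases Nat.even_or_odd' i with ⟨j, rfl | rfl⟩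
  · rw [yNode_even]
    have := key j (by omega)
    constructor <;> linarith
  · rw [yNode_odd]
    have := key j (by omega)
    constructor <;> linarith

theorem approx_mem (hN : 1 ≤ N) (ha : a ∈ Ioo (aMin N) 1) (n : ℕ) :
    ∀ x ∈ Icc (0 : ℝ) 1, approx N a n x ∈ Icc (0 : ℝ) 1 := by
  induction n with
  | zero => exact fun x hx => hx
  | succ n ih =>
    intro x hx
    have hc : cell N x ≤ 2 * N := min_le_right _ _
    have h1 := (convex_Icc (0 : ℝ) 1).add_smul_sub_mem (yNode_mem hN ha (i := cell N x) (by omega))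
      (yNode_mem hN ha (i := cell N x + 1) (by omega)) (ih _ (cell_mem (N := N) hx))
    rw [smul_eq_mul, mul_comm] at h1
    exact h1

theorem tendsto_approx (hN : 1 ≤ N) (ha : a ∈ Ioo (aMin N) 1) {x : ℝ} (hx : x ∈ Icc (0 : ℝ) 1) :
    Tendsto (fun n => approx N a n x) atTop (𝓝 (F N a x)) :=
  (tendstoUniformlyOn_approx hN ha).tendsto_at hx

theorem F_mem (hN : 1 ≤ N) (ha : a ∈ Ioo (aMin N) 1) {x : ℝ} (hx : x ∈ Icc (0 : ℝ) 1) :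
    F N a x ∈ Icc (0 : ℝ) 1 :=
  isClosed_Icc.mem_of_tendsto (tendsto_approx hN ha hx)
    (Eventually.of_forall fun n => approx_mem hN ha n x hx)

theorem F_zero (hN : 1 ≤ N) (ha : a ∈ Ioo (aMin N) 1) : F N a 0 = 0 :=
  tendsto_nhds_unique (tendsto_approx hN ha (by simp))
    (by simp only [(approx_zero_one hN a _).1]; exact tendsto_const_nhds)

theorem F_one (hN : 1 ≤ N) (ha : a ∈ Ioo (aMin N) 1) : F N a 1 = 1 :=
  tendsto_nhds_unique (tendsto_approx hN ha (by simp))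
    (by simp only [(approx_zero_one hN a _).2]; exact tendsto_const_nhds)

theorem add_div_mem (N : ℕ) {n k : ℕ} (hk : k < (2 * N + 1) ^ n) {x : ℝ} (hx : x ∈ Icc (0 : ℝ) 1) :
    ((k : ℝ) + x) / (2 * (N : ℝ) + 1) ^ n ∈ Icc (0 : ℝ) 1 := by
  have hr : (0 : ℝ) < (2 * (N : ℝ) + 1) ^ n := by positivity
  have hk' : (k : ℝ) + 1 ≤ (2 * (N : ℝ) + 1) ^ n := by exact_mod_cast hk
  constructor
  · exact div_nonneg (by linarith [hx.1, k.cast_nonneg (α := ℝ)]) hr.le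
  · rw [div_le_one hr]; linarith [hx.2]

theorem F_add_div (hN : 1 ≤ N) (ha : a ∈ Ioo (aMin N) 1) {i : ℕ} (hi : i ≤ 2 * N) {x : ℝ}
    (hx : x ∈ Icc (0 : ℝ) 1) :
    F N a (((i : ℝ) + x) / (2 * (N : ℝ) + 1)) =
      yNode N a i + a * (-(bParam N a / a)) ^ (i % 2) * F N a x := by
  have hp : (0 : ℝ) < 2 * (N : ℝ) + 1 := by positivity
  have hz : ((i : ℝ) + x) / (2 * (N : ℝ) + 1) ∈ Icc (0 : ℝ) 1 := by
    simpa using add_div_mem N (n := 1) (k := i) (by rw [pow_one]; omega) hx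
  refine tendsto_nhds_unique ((tendsto_add_atTop_iff_nat 1).2 (tendsto_approx hN ha hz)) ?_
  have h1 : ((i : ℝ) + x) / (2 * (N : ℝ) + 1) ∈ Icc (xNode N i) (xNode N (i + 1)) := by
    unfold xNode
    push_cast
    constructor
    · gcongr; linarith [hx.1]
    · gcongr; exact hx.2
  have h2 : (2 * (N : ℝ) + 1) * (((i : ℝ) + x) / (2 * (N : ℝ) + 1) - xNode N i) = x := by
    unfold xNode; field_simp; ring
  simp only [approx_succ hN a _ i hi _ h1, h2, yNode_sub N (pos_of_mem ha).ne']
  exact ((tendsto_approx hN ha hx).const_mul _).const_add _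

/-- On the `k`-th interval of level `n` the graph of `F` is an affine copy of the whole graph; the
copying factor has one factor `a` per even digit of `k` and one factor `-b` per odd digit. -/
theorem F_affine (hN : 1 ≤ N) (ha : a ∈ Ioo (aMin N) 1) (n : ℕ) :
    ∀ k : ℕ, k < (2 * N + 1) ^ n → ∀ x ∈ Icc (0 : ℝ) 1,
    F N a (((k : ℝ) + x) / (2 * (N : ℝ) + 1) ^ n) = F N a ((k : ℝ) / (2 * (N : ℝ) + 1) ^ n) +
      a ^ n * (-(bParam N a / a)) ^ oddDigits N k * F N a x := by
  have hp : (0 : ℝ) < 2 * (N : ℝ) + 1 := by positivity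
  induction n with
  | zero =>
    intro k hk x hx
    have : k = 0 := by simpa using hk
    simp [this, F_zero hN ha]
  | succ n ih =>
    intro k hk x hx
    have hi : k % (2 * N + 1) < 2 * N + 1 := Nat.mod_lt _ (by omega)
    have hq : k / (2 * N + 1) < (2 * N + 1) ^ n := by
      rw [Nat.div_lt_iff_lt_mul (by omega)]; rwa [pow_succ] at hk
    have e := Nat.div_add_mod k (2 * N + 1)
    set q := k / (2 * N + 1)
    set i := k % (2 * N + 1)
    have key : ∀ z ∈ Icc (0 : ℝ) 1, F N a (((k : ℝ) + z) / (2 * (N : ℝ) + 1) ^ (n + 1)) =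
        F N a ((q : ℝ) / (2 * (N : ℝ) + 1) ^ n) +
          a ^ n * (-(bParam N a / a)) ^ oddDigits N q *
            (yNode N a i + a * (-(bParam N a / a)) ^ (i % 2) * F N a z) := by
      intro z hz
      rw [← F_add_div hN ha (by omega) hz, ← ih q hq]
      · congr 1
        rw [← e]; push_cast; field_simp; ring
      · simpa using add_div_mem N (n := 1) (k := i) (by rw [pow_one]; omega) hz
    have h0 := key 0 (by simp)
    rw [add_zero, F_zero hN ha] at h0
    rw [key x hx, h0, ← e, oddDigits_mul_add hN q hi]
    ring

/-! ### Where the derivative vanishes -/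

/-- The number of odd digits among the first `n` base `2N+1` digits of `x`. -/
noncomputable def oddCount (N n : ℕ) (x : ℝ) : ℕ := oddDigits N ⌊x * (2 * (N : ℝ) + 1) ^ n⌋₊

/-- The modulus of the slope of the chord of `F` over the interval of level `n` containing `x`. -/
noncomputable def chordSlope (N : ℕ) (a : ℝ) (n : ℕ) (x : ℝ) : ℝ :=
  ((2 * (N : ℝ) + 1) * a) ^ n * (bParam N a / a) ^ oddCount N n x

theorem floor_lt_pow (N n : ℕ) {x : ℝ} (hx : x ∈ Ioo (0 : ℝ) 1) :
    ⌊x * (2 * (N : ℝ) + 1) ^ n⌋₊ < (2 * N + 1) ^ n := by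
  have hp : (0 : ℝ) < (2 * (N : ℝ) + 1) ^ n := by positivity
  rw [Nat.floor_lt (by have := hx.1; positivity)]
  push_cast
  nlinarith [hx.2]

theorem floor_decomp (N n : ℕ) {x : ℝ} (hx : 0 ≤ x) :
    ∃ t ∈ Icc (0 : ℝ) 1, x = ((⌊x * (2 * (N : ℝ) + 1) ^ n⌋₊ : ℝ) + t) / (2 * (N : ℝ) + 1) ^ n := by
  have hp : (0 : ℝ) < (2 * (N : ℝ) + 1) ^ n := by positivity
  refine ⟨x * (2 * (N : ℝ) + 1) ^ n - ⌊x * (2 * (N : ℝ) + 1) ^ n⌋₊, ⟨?_, ?_⟩, ?_⟩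
  · linarith [Nat.floor_le (show 0 ≤ x * (2 * (N : ℝ) + 1) ^ n by positivity)]
  · linarith [Nat.lt_floor_add_one (x * (2 * (N : ℝ) + 1) ^ n)]
  · field_simp; ring

theorem abs_F_sub_le (hN : 1 ≤ N) (ha : a ∈ Ioo (aMin N) 1) {n k : ℕ} (hk : k < (2 * N + 1) ^ n)
    {s t : ℝ} (hs : s ∈ Icc (0 : ℝ) 1) (ht : t ∈ Icc (0 : ℝ) 1) :
    |F N a (((k : ℝ) + s) / (2 * (N : ℝ) + 1) ^ n) -
      F N a (((k : ℝ) + t) / (2 * (N : ℝ) + 1) ^ n)| ≤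
      a ^ n * (bParam N a / a) ^ oddDigits N k := by
  have h0 := pos_of_mem ha
  have hb := bParam_pos hN ha
  rw [F_affine hN ha n k hk s hs, F_affine hN ha n k hk t ht, add_sub_add_left_eq_sub, ← mul_sub,
    abs_mul, abs_mul, abs_pow, abs_pow, abs_neg, abs_of_pos h0, abs_of_pos (div_pos hb h0)]
  refine mul_le_of_le_one_right (by positivity) ?_
  have h1 := F_mem hN ha hs
  have h2 := F_mem hN ha ht
  exact abs_le.2 ⟨by linarith [h1.1, h2.2], by linarith [h1.2, h2.1]⟩

theorem tendsto_chordSlope (hN : 1 ≤ N) (ha : a ∈ Ioo (aMin N) 1) {x : ℝ}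
    (hx : x ∈ Ioo (0 : ℝ) 1) (hF : HasDerivAt (F N a) 0 x) :
    Tendsto (fun n => chordSlope N a n x) atTop (𝓝 0) := by
  have h0 := pos_of_mem ha
  have hb := bParam_pos hN ha
  have hr1 : (1 : ℝ) < 2 * (N : ℝ) + 1 := by
    have : (0 : ℝ) < N := by exact_mod_cast hN
    linarith
  rw [Metric.tendsto_atTop]
  intro ε hε
  have h1 := (hasDerivAt_iff_isLittleO.1 hF).def (half_pos hε)
  simp only [smul_zero, sub_zero, Real.norm_eq_abs] at h1
  obtain ⟨δ, hδ, h2⟩ := Metric.eventually_nhds_iff.1 h1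
  obtain ⟨m, hm⟩ := exists_pow_lt_of_lt_one hδ (inv_lt_one_of_one_lt₀ hr1)
  refine ⟨m, fun n hn => ?_⟩
  have hp : (0 : ℝ) < (2 * (N : ℝ) + 1) ^ n := by positivity
  have hsmall : ((2 * (N : ℝ) + 1) ^ n)⁻¹ < δ := by
    rw [← inv_pow]
    exact lt_of_le_of_lt (pow_le_pow_of_le_one (by positivity)
      (inv_lt_one_of_one_lt₀ hr1).le hn) hm
  have hk := floor_lt_pow N n hx
  obtain ⟨t, ht, hxt⟩ := floor_decomp N n hx.1.le
  rw [chordSlope, oddCount]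
  set k := ⌊x * (2 * (N : ℝ) + 1) ^ n⌋₊
  have hu : x - (k : ℝ) / (2 * (N : ℝ) + 1) ^ n = t * ((2 * (N : ℝ) + 1) ^ n)⁻¹ := by
    conv_lhs => rw [hxt]
    field_simp; ring
  have hv : ((k : ℝ) + 1) / (2 * (N : ℝ) + 1) ^ n - x =
      (1 - t) * ((2 * (N : ℝ) + 1) ^ n)⁻¹ := by
    conv_lhs => rw [hxt]
    field_simp; ring
  have hi : (0 : ℝ) < ((2 * (N : ℝ) + 1) ^ n)⁻¹ := by positivity
  have hu' : |(k : ℝ) / (2 * (N : ℝ) + 1) ^ n - x| = t * ((2 * (N : ℝ) + 1) ^ n)⁻¹ := by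
    rw [abs_sub_comm, hu, abs_of_nonneg (mul_nonneg ht.1 hi.le)]
  have hv' : |((k : ℝ) + 1) / (2 * (N : ℝ) + 1) ^ n - x| =
      (1 - t) * ((2 * (N : ℝ) + 1) ^ n)⁻¹ := by
    rw [hv, abs_of_nonneg (mul_nonneg (by linarith [ht.2]) hi.le)]
  have e1 := h2 (y := (k : ℝ) / (2 * (N : ℝ) + 1) ^ n) (by
    rw [Real.dist_eq, hu']; nlinarith [ht.1, ht.2])
  have e2 := h2 (y := ((k : ℝ) + 1) / (2 * (N : ℝ) + 1) ^ n) (by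
    rw [Real.dist_eq, hv']; nlinarith [ht.1, ht.2])
  rw [hu'] at e1
  rw [hv'] at e2
  have e3 := F_affine hN ha n k hk 1 (by simp)
  rw [F_one hN ha, mul_one] at e3
  have e4 : |a ^ n * (-(bParam N a / a)) ^ oddDigits N k| ≤
      ε / 2 * ((2 * (N : ℝ) + 1) ^ n)⁻¹ := by
    have : a ^ n * (-(bParam N a / a)) ^ oddDigits N k =
        (F N a (((k : ℝ) + 1) / (2 * (N : ℝ) + 1) ^ n) - F N a x) -
          (F N a ((k : ℝ) / (2 * (N : ℝ) + 1) ^ n) - F N a x) := by rw [e3]; ring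
    rw [this]
    refine (abs_sub _ _).trans ?_
    linarith
  rw [abs_mul, abs_pow, abs_pow, abs_neg, abs_of_pos h0, abs_of_pos (div_pos hb h0)] at e4
  rw [Real.dist_eq, sub_zero, abs_of_nonneg (by positivity), mul_pow, mul_assoc]
  calc _ ≤ (2 * (N : ℝ) + 1) ^ n * (ε / 2 * ((2 * (N : ℝ) + 1) ^ n)⁻¹) := by gcongr
    _ = ε / 2 := by field_simp
    _ < ε := by linarith

/-- No condition on long blocks of the digits `0` and `2N` is needed: the intervals adjacent to
the one containing `x` have comparable slopes by `oddDigits_succ`. -/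
theorem hasDerivAt_zero (hN : 1 ≤ N) (ha : a ∈ Ioo (aMin N) 1) {x : ℝ}
    (hx : x ∈ Ioo (0 : ℝ) 1) (hM : Tendsto (fun n => chordSlope N a n x) atTop (𝓝 0)) :
    HasDerivAt (F N a) 0 x := by
  have h0 := pos_of_mem ha
  have hb := bParam_pos hN ha
  have hba := bParam_lt hN ha
  set c := bParam N a / a with hc
  have hc0 : 0 < c := div_pos hb h0
  have hc1 : c < 1 := (div_lt_one h0).2 hba
  have hr1 : (1 : ℝ) < 2 * (N : ℝ) + 1 := by
    have : (0 : ℝ) < N := by exact_mod_cast hN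
    linarith
  have hr0 : (0 : ℝ) < 2 * (N : ℝ) + 1 := by positivity
  -- neighbouring chords are steeper by a factor at most `1 / c`
  have hnb : ∀ k l : ℕ, oddDigits N k ≤ oddDigits N l + 1 →
      c ^ oddDigits N l ≤ c ^ oddDigits N k * c⁻¹ := by
    intro k l hkl
    rw [← div_eq_mul_inv, le_div_iff₀ hc0, ← pow_succ]
    exact pow_le_pow_of_le_one hc0.le hc1.le hkl
  rw [hasDerivAt_iff_isLittleO, Asymptotics.isLittleO_iff]
  intro ε hε
  simp only [smul_zero, sub_zero, Real.norm_eq_abs]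
  set B : ℝ := (1 + c⁻¹) * (2 * (N : ℝ) + 1) with hB
  have hB0 : 0 < B := by positivity
  obtain ⟨m, hm⟩ := eventually_atTop.1 (hM.eventually (gt_mem_nhds (div_pos hε hB0)))
  have hm0 : (0 : ℝ) < ((2 * (N : ℝ) + 1)⁻¹) ^ m := by positivity
  filter_upwards [Metric.ball_mem_nhds x hm0, Ioo_mem_nhds hx.1 hx.2] with y hy hy01
  rw [Metric.mem_ball, Real.dist_eq] at hy
  rcases eq_or_ne y x with rfl | hne
  · simp
  have hd : 0 < |y - x| := abs_pos.2 (sub_ne_zero.2 hne)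
  obtain ⟨n, hn1, hn2⟩ := exists_nat_pow_near_of_lt_one hd
    (hy.le.trans (pow_le_one₀ (by positivity) (inv_lt_one_of_one_lt₀ hr1).le))
    (inv_pos.2 hr0) (inv_lt_one_of_one_lt₀ hr1)
  have hmn : m ≤ n := by
    by_contra hlt
    have : n + 1 ≤ m := by omega
    exact absurd (hn1.trans hy)
      (not_lt.2 (pow_le_pow_of_le_one (by positivity) (inv_lt_one_of_one_lt₀ hr1).le this))
  have hMn := hm n hmn
  rw [chordSlope, oddCount] at hMn
  have hp : (0 : ℝ) < (2 * (N : ℝ) + 1) ^ n := by positivity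
  have hkx := floor_lt_pow N n hx
  have hky := floor_lt_pow N n hy01
  obtain ⟨s, hs, hxs⟩ := floor_decomp N n hx.1.le
  obtain ⟨t, ht, hyt⟩ := floor_decomp N n hy01.1.le
  have hdist : |y * (2 * (N : ℝ) + 1) ^ n - x * (2 * (N : ℝ) + 1) ^ n| ≤ 1 := by
    rw [← sub_mul, abs_mul, abs_of_pos hp]
    rw [inv_pow] at hn2
    calc _ ≤ ((2 * (N : ℝ) + 1) ^ n)⁻¹ * (2 * (N : ℝ) + 1) ^ n := by gcongr
      _ = 1 := inv_mul_cancel₀ hp.ne'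
  have hfl : ∀ u v : ℝ, 0 ≤ u → |v - u| ≤ 1 → ⌊v⌋₊ ≤ ⌊u⌋₊ + 1 := by
    intro u v hu huv
    rw [← Nat.floor_add_one hu]
    exact Nat.floor_mono (by linarith [(abs_le.1 huv).2])
  have hxn : 0 ≤ x * (2 * (N : ℝ) + 1) ^ n := mul_nonneg hx.1.le hp.le
  have hyn : 0 ≤ y * (2 * (N : ℝ) + 1) ^ n := mul_nonneg hy01.1.le hp.le
  have f1 := hfl _ _ hxn hdist
  have f2 := hfl _ _ hyn (by rwa [abs_sub_comm] at hdist)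
  set k := ⌊x * (2 * (N : ℝ) + 1) ^ n⌋₊
  set l := ⌊y * (2 * (N : ℝ) + 1) ^ n⌋₊
  have hS : 0 < a ^ n * c ^ oddDigits N k := by positivity
  have hadj : ∀ l', oddDigits N k ≤ oddDigits N l' + 1 →
      a ^ n * c ^ oddDigits N l' ≤ a ^ n * c ^ oddDigits N k * c⁻¹ := by
    intro l' hl'
    rw [mul_assoc]
    gcongr
    exact hnb k l' hl'
  have main : |F N a y - F N a x| ≤ (1 + c⁻¹) * (a ^ n * c ^ oddDigits N k) := by
    rw [hxs, hyt]
    rcases lt_trichotomy l k with hlk | hlk | hlk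
    · have hkl : k = l + 1 := by omega
      have g1 := abs_F_sub_le hN ha hkx (s := s) (t := 0) hs (by simp)
      have g2 := abs_F_sub_le hN ha hky (s := t) (t := 1) ht (by simp)
      have g3 : ((k : ℝ) + 0) = (l : ℝ) + 1 := by rw [hkl]; push_cast; ring
      rw [g3, abs_sub_comm] at g1
      have g4 := hadj l (by rw [hkl]; exact (oddDigits_succ hN l).1)
      refine (abs_sub_le _ (F N a (((l : ℝ) + 1) / (2 * (N : ℝ) + 1) ^ n)) _).trans ?_
      linarith
    · rw [hlk]
      refine (abs_F_sub_le hN ha hkx ht hs).trans ?_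
      have : 0 < c⁻¹ := by positivity
      nlinarith
    · have hkl : l = k + 1 := by omega
      have g1 := abs_F_sub_le hN ha hkx (s := s) (t := 1) hs (by simp)
      have g2 := abs_F_sub_le hN ha hky (s := t) (t := 0) ht (by simp)
      have g3 : ((l : ℝ) + 0) = (k : ℝ) + 1 := by rw [hkl]; push_cast; ring
      rw [abs_sub_comm] at g1
      rw [g3] at g2
      have g4 := hadj l (by rw [hkl]; exact (oddDigits_succ hN k).2)
      refine (abs_sub_le _ (F N a (((k : ℝ) + 1) / (2 * (N : ℝ) + 1) ^ n)) _).trans ?_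
      linarith
  rw [lt_div_iff₀ hB0, mul_pow] at hMn
  have hn1' : 1 < |y - x| * (2 * (N : ℝ) + 1) ^ (n + 1) := by
    rw [inv_pow, inv_lt_iff_one_lt_mul₀ (by positivity)] at hn1
    linarith
  calc |F N a y - F N a x| ≤ (1 + c⁻¹) * (a ^ n * c ^ oddDigits N k) := main
    _ ≤ (1 + c⁻¹) * (a ^ n * c ^ oddDigits N k) * (|y - x| * (2 * (N : ℝ) + 1) ^ (n + 1)) :=
        le_mul_of_one_le_right (by positivity) hn1'.le
    _ = ((2 * (N : ℝ) + 1) ^ n * a ^ n * c ^ oddDigits N k * B) * |y - x| := by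
        rw [hB, pow_succ]; ring
    _ ≤ ε * |y - x| := by gcongr

theorem mem_zeroDerivSet_iff (hN : 1 ≤ N) (ha : a ∈ Ioo (aMin N) 1) {x : ℝ} :
    x ∈ zeroDerivSet N a ↔
      x ∈ Ioo (0 : ℝ) 1 ∧ Tendsto (fun n => chordSlope N a n x) atTop (𝓝 0) :=
  ⟨fun h => ⟨h.1, tendsto_chordSlope hN ha h.1 h.2⟩, fun h => ⟨h.1, hasDerivAt_zero hN ha h.1 h.2⟩⟩

/-! ### An upper bound for the dimension of limsup sets -/

/-- A limsup set of intervals of level `n`, at most `(2N+1)^{dn}` of them at level `n`, has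
dimension at most `d`: for `s > d` the tails of `∑ (2N+1)^{n(d-s)}` bound its `s`-dimensional
measure. -/
theorem dimH_limsup_le {N : ℕ} (hN : 1 ≤ N) {d : ℝ} (A : ℕ → Finset ℕ)
    (hA : ∀ n, ((A n).card : ℝ) ≤ ((2 * (N : ℝ) + 1) ^ d) ^ n) :
    dimH {x : ℝ | x ∈ Ioo (0 : ℝ) 1 ∧ ∃ᶠ n in atTop, ⌊x * (2 * (N : ℝ) + 1) ^ n⌋₊ ∈ A n} ≤
      ENNReal.ofReal d := by
  set S := {x : ℝ | x ∈ Ioo (0 : ℝ) 1 ∧ ∃ᶠ n in atTop, ⌊x * (2 * (N : ℝ) + 1) ^ n⌋₊ ∈ A n}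
  have hr1 : (1 : ℝ) < 2 * (N : ℝ) + 1 := by
    have : (0 : ℝ) < N := by exact_mod_cast hN
    linarith
  have hr0 : (0 : ℝ) < 2 * (N : ℝ) + 1 := by positivity
  refine le_of_forall_gt_imp_ge_of_dense fun s' hs' => ?_
  rcases eq_or_ne s' ∞ with rfl | hs'top
  · exact le_top
  lift s' to ℝ≥0 using hs'top
  have hds : d < (s' : ℝ) := by
    by_contra! hc
    refine absurd hs' (not_lt.2 ?_)
    rw [← ENNReal.ofReal_coe_nnreal]
    exact ENNReal.ofReal_le_ofReal hc
  set s : ℝ := (s' : ℝ)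
  refine dimH_le_of_hausdorffMeasure_ne_top (ne_of_lt (lt_of_le_of_lt ?_ ENNReal.zero_lt_top))
  set θ : ℝ := (2 * (N : ℝ) + 1) ^ (d - s) with hθ
  have hθ0 : 0 < θ := by positivity
  have hθ1 : θ < 1 := Real.rpow_lt_one_of_one_lt_of_neg hr1 (by linarith)
  let I : ℕ → ℕ → Set ℝ := fun n k =>
    Icc ((k : ℝ) / (2 * (N : ℝ) + 1) ^ n) (((k : ℝ) + 1) / (2 * (N : ℝ) + 1) ^ n)
  have hI : ∀ n k, Metric.ediam (I n k) = ENNReal.ofReal (((2 * (N : ℝ) + 1)⁻¹) ^ n) := by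
    intro n k
    rw [Real.ediam_Icc]
    congr 1
    rw [inv_pow]; field_simp; ring
  have hlev : ∀ n, ∑' _ : A n, ENNReal.ofReal (((2 * (N : ℝ) + 1)⁻¹) ^ n) ^ s ≤
      ENNReal.ofReal θ ^ n := by
    intro n
    rw [tsum_fintype, Finset.sum_const, Finset.card_univ, Fintype.card_coe,
      ENNReal.ofReal_rpow_of_pos (by positivity), nsmul_eq_mul, ← ENNReal.ofReal_natCast,
      ← ENNReal.ofReal_mul (by positivity), ← ENNReal.ofReal_pow hθ0.le]
    apply ENNReal.ofReal_le_ofReal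
    calc ((A n).card : ℝ) * (((2 * (N : ℝ) + 1)⁻¹) ^ n) ^ s
        ≤ ((2 * (N : ℝ) + 1) ^ d) ^ n * (((2 * (N : ℝ) + 1)⁻¹) ^ n) ^ s := by
          gcongr; exact hA n
      _ = θ ^ n := by
          rw [hθ, Real.rpow_sub hr0, div_pow, div_eq_mul_inv, ← Real.rpow_natCast (_⁻¹) n,
            ← Real.rpow_mul (by positivity), mul_comm (n : ℝ) s, Real.rpow_mul (by positivity),
            Real.rpow_natCast, Real.inv_rpow hr0.le, inv_pow]
  have hsum : ∑' n, ENNReal.ofReal θ ^ n ≠ ∞ := by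
    rw [ENNReal.tsum_geometric]
    refine ENNReal.inv_ne_top.2 (ne_of_gt (tsub_pos_of_lt ?_))
    rw [← ENNReal.ofReal_one]
    exact (ENNReal.ofReal_lt_ofReal_iff one_pos).2 hθ1
  -- the `m`-th cover consists of all chosen intervals of levels at least `m`
  have hcov := MeasureTheory.Measure.hausdorffMeasure_le_liminf_tsum
    (ι := fun m : ℕ => Σ n : ℕ, A (n + m)) s S (l := atTop)
    (fun m => ENNReal.ofReal (((2 * (N : ℝ) + 1)⁻¹) ^ m)) ?_ (fun m i => I (i.1 + m) i.2.1) ?_ ?_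
  · refine hcov.trans ?_
    have hlim : Tendsto (fun m => ∑' n, ENNReal.ofReal θ ^ (n + m)) atTop (𝓝 0) :=
      ENNReal.tendsto_sum_nat_add _ hsum
    refine (liminf_le_liminf (Eventually.of_forall fun m => ?_)).trans hlim.liminf_eq.le
    simp only [hI]
    refine (ENNReal.tsum_sigma (fun (n : ℕ) (_ : A (n + m)) =>
      ENNReal.ofReal (((2 * (N : ℝ) + 1)⁻¹) ^ (n + m)) ^ s)).trans_le ?_
    exact ENNReal.tsum_le_tsum fun n => hlev (n + m)
  · rw [← ENNReal.ofReal_zero]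
    exact ENNReal.tendsto_ofReal (tendsto_pow_atTop_nhds_zero_of_lt_one (by positivity)
      (inv_lt_one_of_one_lt₀ hr1))
  · refine Eventually.of_forall fun m i => ?_
    rw [hI]
    exact ENNReal.ofReal_le_ofReal (pow_le_pow_of_le_one (by positivity)
      (inv_lt_one_of_one_lt₀ hr1).le (by omega))
  · refine Eventually.of_forall fun m x hx => ?_
    obtain ⟨n, hn, hxn⟩ := frequently_atTop.1 hx.2 m
    obtain ⟨j, rfl⟩ := Nat.exists_eq_add_of_le' hn
    refine mem_iUnion.2 ⟨⟨j, ⟨_, hxn⟩⟩, ?_⟩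
    have hp : (0 : ℝ) < (2 * (N : ℝ) + 1) ^ (j + m) := by positivity
    exact ⟨(div_le_iff₀ hp).2 (Nat.floor_le (mul_nonneg hx.1.1.le hp.le)),
      (le_div_iff₀ hp).2 (Nat.lt_floor_add_one _).le⟩

/-! ### The entropy function -/

theorem log_pos_of_one_le {N : ℕ} (hN : 1 ≤ N) : 0 < Real.log (2 * (N : ℝ) + 1) := by
  have : (0 : ℝ) < N := by exact_mod_cast hN
  exact Real.log_pos (by linarith)

theorem h_eq {N : ℕ} (hN : 1 ≤ N) (p : ℝ) :
    h N p = (Real.negMulLog p + p * Real.log N + Real.negMulLog (1 - p) +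
      (1 - p) * Real.log ((N : ℝ) + 1)) / Real.log (2 * (N : ℝ) + 1) := by
  have hNp : (N : ℝ) ≠ 0 := by positivity
  have hN1 : (N : ℝ) + 1 ≠ 0 := by positivity
  have key : ∀ x c : ℝ, c ≠ 0 → x * Real.log (x / c) = x * Real.log x - x * Real.log c := by
    intro x c hc
    rcases eq_or_ne x 0 with rfl | hx
    · simp
    · rw [Real.log_div hx hc]; ring
  rw [h, key _ _ hNp, key _ _ hN1, Real.negMulLog, Real.negMulLog]
  ring

theorem continuous_h {N : ℕ} (hN : 1 ≤ N) : Continuous (h N) := by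
  have : h N = fun p => _ := funext (h_eq hN)
  rw [this]
  have := Real.continuous_negMulLog
  fun_prop

/-- The ratio of the weights of odd and even digits under which `p` is the frequency of odd
digits. -/
noncomputable def tilt (N : ℕ) (p : ℝ) : ℝ := p * ((N : ℝ) + 1) / (N * (1 - p))

theorem tilt_pos {N : ℕ} (hN : 1 ≤ N) {p : ℝ} (hp : p ∈ Ioo (0 : ℝ) 1) : 0 < tilt N p := by
  have hNp : (0 : ℝ) < N := by exact_mod_cast hN
  have := hp.1
  have : 0 < 1 - p := by linarith [hp.2]
  unfold tilt; positivity

/-- The tilted generating function evaluated at its own frequency is the exponential of the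
entropy. -/
theorem log_tilt_sum {N : ℕ} (hN : 1 ≤ N) {p : ℝ} (hp : p ∈ Ioo (0 : ℝ) 1) :
    Real.log (N * tilt N p + ((N : ℝ) + 1)) =
      h N p * Real.log (2 * (N : ℝ) + 1) + p * Real.log (tilt N p) := by
  have hNp : (0 : ℝ) < N := by exact_mod_cast hN
  have h0 := hp.1
  have h1 : 0 < 1 - p := by linarith [hp.2]
  have e : (N : ℝ) * tilt N p + ((N : ℝ) + 1) = ((N : ℝ) + 1) / (1 - p) := by
    unfold tilt; field_simp; ring
  rw [e, h_eq hN, div_mul_cancel₀ _ (log_pos_of_one_le hN).ne', tilt,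
    Real.log_div (by positivity) h1.ne', Real.log_div (by positivity) (by positivity),
    Real.log_mul h0.ne' (by positivity), Real.log_mul hNp.ne' h1.ne', Real.negMulLog,
    Real.negMulLog]
  ring

/-- The exponential counting bound `card ≤ (2N+1)^{n d}` with `d` the entropy at `p`, corrected by
the deviation of `q` from `p`. -/
theorem card_le_rpow {N : ℕ} (hN : 1 ≤ N) {p : ℝ} (hp : p ∈ Ioo (0 : ℝ) 1) (q : ℝ) (n : ℕ)
    (A : Finset ℕ) (hA : ∀ k ∈ A, k < (2 * N + 1) ^ n ∧
      tilt N p ^ (q * n) ≤ tilt N p ^ oddDigits N k) :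
    (A.card : ℝ) ≤ ((2 * (N : ℝ) + 1) ^
      (h N p + (p - q) * Real.log (tilt N p) / Real.log (2 * (N : ℝ) + 1))) ^ n := by
  have ht := tilt_pos hN hp
  have hr0 : (0 : ℝ) < 2 * (N : ℝ) + 1 := by positivity
  have hl := log_pos_of_one_le hN
  have hs : 0 < (N : ℝ) * tilt N p + ((N : ℝ) + 1) := by positivity
  have h1 := card_mul_rpow_le hN ht q n A hA
  rw [← le_div_iff₀ (by positivity)] at h1
  refine h1.trans (le_of_eq ?_)
  rw [Real.rpow_mul ht.le, Real.rpow_natCast, ← div_pow]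
  congr 1
  rw [Real.rpow_def_of_pos hr0, Real.rpow_def_of_pos ht, ← Real.exp_log hs, log_tilt_sum hN hp,
    ← Real.exp_sub]
  congr 1
  field_simp
  ring

/-! ### Cantor sets defined by digit substitution -/

/-- Replaces each of the last `n` base `m` digits `d` of `k` by the base `R` digit `σ d`, keeping
the leading part of `k`. -/
def substDigits (σ : ℕ → ℕ) (m R : ℕ) : ℕ → ℕ → ℕ
  | 0, k => k
  | n + 1, k => R * substDigits σ m R n (k / m) + σ (k % m)

/-- The real number whose base `R` digits are the images under `σ` of the base `m` digits of
`t`. -/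
noncomputable def substPoint (σ : ℕ → ℕ) (m R : ℕ) (t : ℝ) : ℝ :=
  ⨆ n : ℕ, (substDigits σ m R n ⌊t * (m : ℝ) ^ n⌋₊ : ℝ) / (R : ℝ) ^ n

section Subst

variable {σ : ℕ → ℕ} {m R : ℕ}

theorem substDigits_strictMono (hm : 0 < m) (hσ : ∀ i < m, σ i + 1 < R)
    (hσm : ∀ i j, i < j → j < m → σ i < σ j) (n : ℕ) : StrictMono (substDigits σ m R n) := by
  induction n with
  | zero => exact fun _ _ h => h
  | succ n ih =>
    intro k l hkl
    have hk := hσ _ (Nat.mod_lt k hm)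
    simp only [substDigits]
    rcases lt_or_eq_of_le (Nat.div_le_div_right (c := m) hkl.le) with h | h
    · have h1 : substDigits σ m R n (k / m) + 1 ≤ substDigits σ m R n (l / m) := ih h
      have h2 := Nat.mul_le_mul_left R h1
      rw [Nat.mul_add, Nat.mul_one] at h2
      omega
    · rw [h]
      have h1 := Nat.div_add_mod k m
      have h2 := Nat.div_add_mod l m
      rw [h] at h1
      have := hσm (k % m) (l % m) (by omega) (Nat.mod_lt l hm)
      omega

theorem floor_mul_pow_succ_div (hm : 0 < m) (t : ℝ) (n : ℕ) :
    ⌊t * (m : ℝ) ^ (n + 1)⌋₊ / m = ⌊t * (m : ℝ) ^ n⌋₊ := by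
  rw [← Nat.floor_div_natCast]
  congr 1
  have : (m : ℝ) ≠ 0 := by positivity
  rw [pow_succ]; field_simp

/-- All intervals of the nested sequence defining `substPoint` contain it, and its floors are the
substituted integers; the digit `R - 1` is excluded so that no carries occur. -/
theorem substPoint_spec (hm : 0 < m) (hσ : ∀ i < m, σ i + 1 < R) (t : ℝ) (n : ℕ) :
    (substDigits σ m R n ⌊t * (m : ℝ) ^ n⌋₊ : ℝ) ≤ substPoint σ m R t * (R : ℝ) ^ n ∧
      substPoint σ m R t * (R : ℝ) ^ n < substDigits σ m R n ⌊t * (m : ℝ) ^ n⌋₊ + 1 := by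
  have hR : 0 < R := by have := hσ 0 hm; omega
  have hR' : (0 : ℝ) < R := by exact_mod_cast hR
  set S : ℕ → ℕ := fun n => substDigits σ m R n ⌊t * (m : ℝ) ^ n⌋₊ with hS
  have hstep : ∀ n, ∃ d, d + 1 < R ∧ S (n + 1) = R * S n + d := by
    intro n
    refine ⟨_, hσ _ (Nat.mod_lt ⌊t * (m : ℝ) ^ (n + 1)⌋₊ hm), ?_⟩
    simp only [hS, substDigits, floor_mul_pow_succ_div hm]
  have hlo : Monotone fun n => (S n : ℝ) / (R : ℝ) ^ n := by
    refine monotone_nat_of_le_succ fun n => ?_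
    obtain ⟨d, -, hd⟩ := hstep n
    rw [hd, div_le_div_iff₀ (by positivity) (by positivity), pow_succ]
    push_cast
    have : (0 : ℝ) ≤ (d : ℝ) * (R : ℝ) ^ n := by positivity
    nlinarith
  have hup' : ∀ n, ((S (n + 1) : ℝ) + 1) / (R : ℝ) ^ (n + 1) < ((S n : ℝ) + 1) / (R : ℝ) ^ n := by
    intro n
    obtain ⟨d, hdR, hd⟩ := hstep n
    have hdR' : (d : ℝ) + 1 < R := by exact_mod_cast hdR
    rw [hd, div_lt_div_iff₀ (by positivity) (by positivity), pow_succ]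
    push_cast
    have : ((d : ℝ) + 1) * (R : ℝ) ^ n < R * (R : ℝ) ^ n := by gcongr
    nlinarith
  have hup : Antitone fun n => ((S n : ℝ) + 1) / (R : ℝ) ^ n :=
    antitone_nat_of_succ_le fun n => (hup' n).le
  have hx := hlo.ciSup_mem_iInter_Icc_of_antitone hup fun n => by
    simp only; gcongr; linarith
  rw [mem_iInter] at hx
  have hp : (0 : ℝ) < (R : ℝ) ^ n := by positivity
  exact ⟨(div_le_iff₀ hp).1 (hx n).1, (lt_div_iff₀ hp).1 ((hx (n + 1)).2.trans_lt (hup' n))⟩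

theorem floor_substPoint (hm : 0 < m) (hσ : ∀ i < m, σ i + 1 < R) (t : ℝ) (n : ℕ) :
    ⌊substPoint σ m R t * (R : ℝ) ^ n⌋₊ = substDigits σ m R n ⌊t * (m : ℝ) ^ n⌋₊ := by
  have := substPoint_spec hm hσ t n
  exact (Nat.floor_eq_iff (le_trans (Nat.cast_nonneg _) this.1)).2 this

/-- The substitution preserves order, so points two intervals apart at level `n` are mapped to
points at least `R^{-n}` apart. -/
theorem substPoint_sub_ge (hm : 0 < m) (hσ : ∀ i < m, σ i + 1 < R)
    (hσm : ∀ i j, i < j → j < m → σ i < σ j) {s t : ℝ} (hs : 0 ≤ s) {n : ℕ}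
    (hst : 2 * ((m : ℝ)⁻¹) ^ n ≤ t - s) :
    ((R : ℝ)⁻¹) ^ n ≤ substPoint σ m R t - substPoint σ m R s := by
  have hR : 0 < R := by have := hσ 0 hm; omega
  have hR' : (0 : ℝ) < R := by exact_mod_cast hR
  have hm' : (0 : ℝ) < m := by exact_mod_cast hm
  have h1 : ⌊s * (m : ℝ) ^ n⌋₊ + 2 ≤ ⌊t * (m : ℝ) ^ n⌋₊ := by
    rw [← Nat.floor_add_ofNat (by positivity)]
    refine Nat.floor_mono ?_
    rw [inv_pow, ← div_eq_mul_inv, div_le_iff₀ (by positivity)] at hst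
    linarith
  have hmono := substDigits_strictMono hm hσ hσm n
  have h2 : substDigits σ m R n ⌊s * (m : ℝ) ^ n⌋₊ + 2 ≤
      substDigits σ m R n ⌊t * (m : ℝ) ^ n⌋₊ := by
    have a1 := hmono (show ⌊s * (m : ℝ) ^ n⌋₊ < ⌊s * (m : ℝ) ^ n⌋₊ + 1 by omega)
    have a2 := hmono (show ⌊s * (m : ℝ) ^ n⌋₊ + 1 < ⌊s * (m : ℝ) ^ n⌋₊ + 2 by omega)
    have a3 := hmono.monotone h1
    omega
  have h3 : (substDigits σ m R n ⌊s * (m : ℝ) ^ n⌋₊ : ℝ) + 2 ≤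
      substDigits σ m R n ⌊t * (m : ℝ) ^ n⌋₊ := by exact_mod_cast h2
  rw [inv_pow, inv_le_iff_one_le_mul₀ (by positivity)]
  linarith [(substPoint_spec hm hσ t n).1, (substPoint_spec hm hσ s n).2]

/-- The inverse of the substitution map is Hölder continuous of order `log m / log R`, so the
Cantor set is at least of this dimension. -/
theorem le_dimH_image_substPoint (hm : 2 ≤ m) (hσ : ∀ i < m, σ i + 1 < R)
    (hσm : ∀ i j, i < j → j < m → σ i < σ j) :
    ENNReal.ofReal (Real.log m / Real.log R) ≤ dimH (substPoint σ m R '' Ico 0 1) := by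
  have hm0 : 0 < m := by omega
  have hm' : (1 : ℝ) < m := by exact_mod_cast hm
  have hR : 2 ≤ R := by have := hσ 0 hm0; omega
  have hR' : (1 : ℝ) < R := by exact_mod_cast hR
  have hlR := Real.log_pos hR'
  set e : ℝ := Real.log m / Real.log R with he
  have he0 : 0 < e := div_pos (Real.log_pos hm') hlR
  have hRe : (R : ℝ) ^ e = m := by
    rw [Real.rpow_def_of_pos (by linarith), he, mul_div_cancel₀ _ hlR.ne',
      Real.exp_log (by linarith)]
  have key : ∀ s ∈ Ico (0 : ℝ) 1, ∀ t ∈ Ico (0 : ℝ) 1,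
      |s - t| ≤ 2 * m * |substPoint σ m R s - substPoint σ m R t| ^ e := by
    have hlt : ∀ s ∈ Ico (0 : ℝ) 1, ∀ t ∈ Ico (0 : ℝ) 1, s < t →
        |s - t| ≤ 2 * m * |substPoint σ m R s - substPoint σ m R t| ^ e := by
      intro s hs t ht hst
      obtain ⟨n, hn1, hn2⟩ := exists_nat_pow_near_of_lt_one (x := (t - s) / 2)
        (y := (m : ℝ)⁻¹) (by linarith) (by linarith [ht.2, hs.1]) (by positivity)
        (inv_lt_one_of_one_lt₀ hm')
      have h1 := substPoint_sub_ge hm0 hσ hσm hs.1 (n := n + 1) (t := t) (by linarith)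
      have hRn : (0 : ℝ) < ((R : ℝ)⁻¹) ^ (n + 1) := by positivity
      rw [abs_sub_comm, abs_of_pos (sub_pos.2 hst), abs_sub_comm,
        abs_of_pos (lt_of_lt_of_le hRn h1)]
      have h2 : ((m : ℝ)⁻¹) ^ (n + 1) ≤ (substPoint σ m R t - substPoint σ m R s) ^ e := by
        refine le_trans (le_of_eq ?_) (Real.rpow_le_rpow hRn.le h1 he0.le)
        rw [inv_pow, inv_pow, Real.inv_rpow (by positivity), ← Real.rpow_natCast (R : ℝ),
          ← Real.rpow_mul (by positivity), mul_comm, Real.rpow_mul (by positivity), hRe,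
          Real.rpow_natCast]
      calc t - s ≤ 2 * ((m : ℝ)⁻¹) ^ n := by linarith
        _ = 2 * m * ((m : ℝ)⁻¹) ^ (n + 1) := by rw [pow_succ]; field_simp
        _ ≤ _ := by gcongr
    intro s hs t ht
    rcases lt_trichotomy s t with h | rfl | h
    · exact hlt s hs t ht h
    · rw [sub_self, abs_zero]; positivity
    · rw [abs_sub_comm, abs_sub_comm (substPoint σ m R s)]
      exact hlt t ht s hs h
  have hinj : InjOn (substPoint σ m R) (Ico 0 1) := by
    intro s hs t ht hst
    have := key s hs t ht
    rw [hst, sub_self, abs_zero, Real.zero_rpow he0.ne', mul_zero] at this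
    exact sub_eq_zero.1 (abs_nonpos_iff.1 this)
  set g := Function.invFunOn (substPoint σ m R) (Ico (0 : ℝ) 1) with hg
  have hgl : ∀ t ∈ Ico (0 : ℝ) 1, g (substPoint σ m R t) = t := hinj.leftInvOn_invFunOn
  have hee : ((e.toNNReal : ℝ≥0) : ℝ) = e := Real.coe_toNNReal e he0.le
  have he0' : 0 < e.toNNReal := Real.toNNReal_pos.2 he0
  have hhol : HolderOnWith (2 * (m : ℝ≥0)) e.toNNReal g (substPoint σ m R '' Ico 0 1) := by
    rintro _ ⟨s, hs, rfl⟩ _ ⟨t, ht, rfl⟩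
    rw [hgl s hs, hgl t ht, edist_dist, edist_dist, Real.dist_eq, Real.dist_eq, hee,
      ENNReal.ofReal_rpow_of_nonneg (abs_nonneg _) he0.le, ← ENNReal.ofReal_coe_nnreal,
      ← ENNReal.ofReal_mul (by positivity)]
    exact ENNReal.ofReal_le_ofReal (by simpa using key s hs t ht)
  have himg : g '' (substPoint σ m R '' Ico 0 1) = Ico 0 1 := by
    rw [image_image]
    exact (image_congr hgl).trans (image_id' _)
  have hdim := hhol.dimH_image_le he0'
  rw [himg, Real.dimH_of_nonempty_interior (by rw [interior_Ico]; exact nonempty_Ioo.2 one_pos),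
    Module.finrank_self, Nat.cast_one, ENNReal.le_div_iff_mul_le
      (Or.inl (ENNReal.coe_ne_zero.2 he0'.ne')) (Or.inl ENNReal.coe_ne_top), one_mul] at hdim
  exact hdim

end Subst

theorem oddDigits_pow_sub_one {N : ℕ} (hN : 1 ≤ N) (K : ℕ) :
    oddDigits N ((2 * N + 1) ^ K - 1) = 0 := by
  induction K with
  | zero => simp
  | succ K ih =>
    have h1 : 1 ≤ (2 * N + 1) ^ K := Nat.one_le_pow _ _ (by omega)
    have h2 : (2 * N + 1) ^ (K + 1) - 1 = (2 * N + 1) * ((2 * N + 1) ^ K - 1) + 2 * N := by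
      obtain ⟨c, hc⟩ := Nat.exists_eq_add_of_le' h1
      rw [pow_succ, hc, Nat.add_sub_cancel, Nat.mul_comm, Nat.mul_add, Nat.mul_one]
      omega
    rw [h2, oddDigits_mul_add hN _ (by omega), ih]
    omega

/-- Prescribing the number of odd digits in each block of length `K` yields a Cantor set of large
dimension. -/
theorem le_dimH_blocks {N : ℕ} (hN : 1 ≤ N) {K j : ℕ} (hj : 1 ≤ j) (hjK : j ≤ K) :
    ENNReal.ofReal (Real.log ((K.choose j : ℝ) * (N : ℝ) ^ j * ((N : ℝ) + 1) ^ (K - j)) /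
      (K * Real.log (2 * (N : ℝ) + 1))) ≤
      dimH {x : ℝ | x ∈ Ioo (0 : ℝ) 1 ∧ ∀ n, oddCount N (K * n) x = n * j} := by
  set R := (2 * N + 1) ^ K with hR
  set W := (Finset.range R).filter (fun k => oddDigits N k = j) with hW
  set m := W.card with hmdef
  have hmc : (K.choose j : ℝ) * (N : ℝ) ^ j * ((N : ℝ) + 1) ^ (K - j) = m := by
    rw [hmdef, hW, hR, card_oddDigits_eq hN K j hjK]; push_cast; ring
  have hRc : (K : ℝ) * Real.log (2 * (N : ℝ) + 1) = Real.log R := by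
    rw [hR]; push_cast; rw [Real.log_pow]
  rw [hmc, hRc]
  rcases lt_or_ge m 2 with hm | hm
  · have : Real.log m ≤ 0 := Real.log_nonpos (by positivity) (by exact_mod_cast (by omega : m ≤ 1))
    rw [ENNReal.ofReal_of_nonpos
      (div_nonpos_of_nonpos_of_nonneg this (Real.log_natCast_nonneg _))]
    exact zero_le
  set σ : ℕ → ℕ := fun i => if hi : i < m then W.orderEmbOfFin rfl ⟨i, hi⟩ else 0 with hσdef
  have hσW : ∀ i < m, σ i ∈ W := by
    intro i hi
    simp only [hσdef, dif_pos hi]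
    exact W.orderEmbOfFin_mem rfl _
  have hσj : ∀ i < m, oddDigits N (σ i) = j := fun i hi => (Finset.mem_filter.1 (hσW i hi)).2
  have hσR' : ∀ i < m, σ i < R := fun i hi =>
    Finset.mem_range.1 (Finset.mem_filter.1 (hσW i hi)).1
  have hσR : ∀ i < m, σ i + 1 < R := by
    intro i hi
    have h1 := hσR' i hi
    have h2 : σ i ≠ R - 1 := by
      intro h
      have := hσj i hi
      rw [h, hR, oddDigits_pow_sub_one hN] at this
      omega
    omega
  have hσm : ∀ i l, i < l → l < m → σ i < σ l := by
    intro i l hil hl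
    simp only [hσdef, dif_pos hl, dif_pos (hil.trans hl)]
    exact (W.orderEmbOfFin rfl).strictMono (by simpa using hil)
  have hm0 : 0 < m := by omega
  refine (le_dimH_image_substPoint hm hσR hσm).trans (dimH_mono ?_)
  have hodd : ∀ n k, k < m ^ n → oddDigits N (substDigits σ m R n k) = n * j := by
    intro n
    induction n with
    | zero =>
      intro k hk
      have : k = 0 := by simpa using hk
      simp [this, substDigits]
    | succ n ih =>
      intro k hk
      have hk' : k / m < m ^ n := by
        rw [Nat.div_lt_iff_lt_mul hm0]; rwa [pow_succ] at hk
      have hkm := Nat.mod_lt k hm0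
      rw [substDigits, hR, oddDigits_pow_mul_add hN K _ (hσR' _ hkm), ← hR, ih _ hk', hσj _ hkm]
      ring
  rintro _ ⟨t, ht, rfl⟩
  have hcount : ∀ n, oddCount N (K * n) (substPoint σ m R t) = n * j := by
    intro n
    have e : (2 * (N : ℝ) + 1) ^ (K * n) = (R : ℝ) ^ n := by
      rw [hR]; push_cast; rw [pow_mul]
    rw [oddCount, e, floor_substPoint hm0 hσR]
    refine hodd n _ ?_
    rw [Nat.floor_lt (mul_nonneg ht.1 (by positivity))]
    push_cast
    have : (0 : ℝ) < (m : ℝ) ^ n := by positivity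
    nlinarith [ht.2]
  have h01 := substPoint_spec hm0 hσR t 0
  have ht0 : ⌊t⌋₊ = 0 := Nat.floor_eq_zero.2 ht.2
  simp only [pow_zero, mul_one, ht0, substDigits, Nat.cast_zero, zero_add] at h01
  refine ⟨⟨lt_of_le_of_ne h01.1 fun h => ?_, h01.2⟩, hcount⟩
  have := hcount 1
  rw [← h] at this
  simp [oddCount] at this
  omega

/-! ### Entropy of binomial coefficients -/

/-- The largest of the `K+1` terms of the expansion of `(j + (K - j))^K` is the one with
index `j`. -/
theorem pow_self_le_choose {K j : ℕ} (hjK : j < K) :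
    K ^ K ≤ (K + 1) * (j ^ j * (K - j) ^ (K - j) * K.choose j) := by
  set q := K - j with hq
  have hq0 : 0 < q := by omega
  set T : ℕ → ℕ := fun i => j ^ i * q ^ (K - i) * K.choose i with hT
  -- consecutive terms have the ratio `(K - i) j / ((i + 1) q)`, at least 1 exactly for `i < j`
  have hrec : ∀ i < K, T i * ((K - i) * j) = T (i + 1) * ((i + 1) * q) := by
    intro i hi
    have h1 := Nat.choose_succ_right_eq K i
    have h2 : K - i = (K - (i + 1)) + 1 := by omega
    calc T i * ((K - i) * j) = j ^ (i + 1) * q ^ (K - i) * (K.choose i * (K - i)) := by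
          simp only [hT]; ring
      _ = j ^ (i + 1) * q ^ (K - (i + 1) + 1) * (K.choose (i + 1) * (i + 1)) := by rw [h1, ← h2]
      _ = _ := by simp only [hT]; ring
  have hup : ∀ i < j, T i ≤ T (i + 1) := by
    intro i hi
    have h1 : (i + 1) * q ≤ (K - i) * j := by
      rw [mul_comm]; exact Nat.mul_le_mul (by omega) (by omega)
    have h2 := hrec i (by omega)
    refine Nat.le_of_mul_le_mul_right (c := (i + 1) * q) ?_ (by positivity)
    rw [← h2]
    exact Nat.mul_le_mul_left _ h1
  have hdown : ∀ i, j ≤ i → i < K → T (i + 1) ≤ T i := by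
    intro i hi hiK
    have h1 : (K - i) * j ≤ (i + 1) * q := by
      rw [mul_comm]; exact Nat.mul_le_mul (by omega) (by omega)
    have h2 := hrec i hiK
    refine Nat.le_of_mul_le_mul_right (c := (i + 1) * q) ?_ (by positivity)
    rw [← h2]
    exact Nat.mul_le_mul_left _ h1
  have hlow : ∀ d, T (j - d) ≤ T j := by
    intro d
    induction d with
    | zero => exact le_rfl
    | succ d ih =>
      rcases Nat.lt_or_ge d j with h | h
      · have h1 := hup (j - (d + 1)) (by omega)
        rw [show j - (d + 1) + 1 = j - d by omega] at h1
        exact h1.trans ih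
      · rwa [show j - (d + 1) = j - d by omega]
  have hhigh : ∀ d, j + d ≤ K → T (j + d) ≤ T j := by
    intro d
    induction d with
    | zero => exact fun _ => le_rfl
    | succ d ih => exact fun h => (hdown (j + d) (by omega) (by omega)).trans (ih (by omega))
  have hall : ∀ i ∈ Finset.range (K + 1), T i ≤ T j := by
    intro i hi
    rw [Finset.mem_range] at hi
    rcases Nat.le_total i j with h | h
    · have := hlow (j - i); rwa [Nat.sub_sub_self h] at this
    · have := hhigh (i - j) (by omega); rwa [Nat.add_sub_cancel' h] at this
  calc K ^ K = (j + q) ^ K := by rw [hq, Nat.add_sub_cancel' hjK.le]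
    _ = ∑ i ∈ Finset.range (K + 1), T i := by rw [add_pow]; rfl
    _ ≤ (Finset.range (K + 1)).card • T j := Finset.sum_le_card_nsmul _ _ _ hall
    _ = _ := by rw [Finset.card_range, smul_eq_mul]

theorem entropy_le_log_choose {N : ℕ} (hN : 1 ≤ N) {K j : ℕ} (hj : 0 < j) (hjK : j < K) :
    h N ((j : ℝ) / K) - Real.log ((K : ℝ) + 1) / K / Real.log (2 * (N : ℝ) + 1) ≤
      Real.log ((K.choose j : ℝ) * (N : ℝ) ^ j * ((N : ℝ) + 1) ^ (K - j)) /
      (K * Real.log (2 * (N : ℝ) + 1)) := by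
  have hl := log_pos_of_one_le hN
  have hK0 : (0 : ℝ) < K := by exact_mod_cast (by omega : 0 < K)
  have hj0 : (0 : ℝ) < j := by exact_mod_cast hj
  have hjK' : (j : ℝ) < K := by exact_mod_cast hjK
  have hNp : (0 : ℝ) < N := by exact_mod_cast hN
  have hc : (0 : ℝ) < K.choose j := by exact_mod_cast Nat.choose_pos hjK.le
  have hcast : ((K - j : ℕ) : ℝ) = K - j := Nat.cast_sub hjK.le
  have hq0 : (0 : ℝ) < (K : ℝ) - j := by linarith
  have h1 : (K : ℝ) ^ K ≤ (K + 1) * ((j : ℝ) ^ j * ((K : ℝ) - j) ^ (K - j) * K.choose j) := by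
    rw [← hcast]; exact_mod_cast pow_self_le_choose hjK
  have h2 := Real.log_le_log (by positivity) h1
  rw [Real.log_mul (by positivity) (by positivity), Real.log_mul (by positivity) hc.ne',
    Real.log_mul (by positivity) (by positivity), Real.log_pow, Real.log_pow, Real.log_pow,
    hcast] at h2
  rw [Real.log_mul (by positivity) (by positivity), Real.log_mul hc.ne' (by positivity),
    Real.log_pow, Real.log_pow, hcast, h_eq hN, Real.negMulLog, Real.negMulLog,
    show 1 - (j : ℝ) / K = (K - j) / K by field_simp, Real.log_div hj0.ne' hK0.ne',
    Real.log_div hq0.ne' hK0.ne', le_div_iff₀ (by positivity)]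
  generalize Real.log (2 * (N : ℝ) + 1) = L at hl ⊢
  field_simp
  linarith

/-! ### The critical frequency -/

/-- The logarithm of `a / b`, in the form in which it is the denominator of `phi`. -/
noncomputable def logRatio (N : ℕ) (a : ℝ) : ℝ :=
  Real.log ((N : ℝ) * a) - Real.log (((N : ℝ) + 1) * a - 1)

section CriticalFrequency

variable {N : ℕ} {a : ℝ}

theorem aStar_lt_one (hN : 1 ≤ N) : aStar N < 1 := by
  have hNp : (1 : ℝ) ≤ N := by exact_mod_cast hN
  unfold aStar
  rw [div_lt_one (by positivity)]
  nlinarith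

theorem mul_sub_one_pos (ha : a ∈ Ioo (aMin N) 1) : 0 < ((N : ℝ) + 1) * a - 1 := by
  have h1 := ha.1
  unfold aMin at h1
  rw [div_lt_iff₀ (by positivity)] at h1
  linarith

theorem logRatio_eq (hN : 1 ≤ N) (ha : a ∈ Ioo (aMin N) 1) :
    logRatio N a = -Real.log (bParam N a / a) := by
  have hNp : (0 : ℝ) < N := by exact_mod_cast hN
  have h0 := pos_of_mem ha
  have h1 := mul_sub_one_pos ha
  rw [logRatio, bParam, Real.log_div (by positivity) h0.ne', Real.log_div h1.ne' hNp.ne',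
    Real.log_mul hNp.ne' h0.ne']
  ring

theorem logRatio_pos (hN : 1 ≤ N) (ha : a ∈ Ioo (aMin N) 1) : 0 < logRatio N a := by
  have h0 := pos_of_mem ha
  rw [logRatio_eq hN ha, neg_pos]
  exact Real.log_neg (div_pos (bParam_pos hN ha) h0) ((div_lt_one h0).2 (bParam_lt hN ha))

theorem log_expansion_pos (hN : 1 ≤ N) (ha : a ∈ Ioo (aMin N) 1) :
    0 < Real.log ((2 * (N : ℝ) + 1) * a) := Real.log_pos (one_lt_expansion hN ha)

theorem phi_mul_logRatio (hN : 1 ≤ N) (ha : a ∈ Ioo (aMin N) 1) :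
    phi N a * logRatio N a = Real.log ((2 * (N : ℝ) + 1) * a) :=
  div_mul_cancel₀ _ (logRatio_pos hN ha).ne'

theorem mem_Ioo_one (hN : 1 ≤ N) (ha : a ∈ Ioo (aMin N) (aStar N)) : a ∈ Ioo (aMin N) 1 :=
  ⟨ha.1, ha.2.trans (aStar_lt_one hN)⟩

theorem mul_sub_one_lt (ha : a < aStar N) : (2 * (N : ℝ) + 1) * (((N : ℝ) + 1) * a - 1) < N := by
  unfold aStar at ha
  rw [lt_div_iff₀ (by positivity)] at ha
  linarith

theorem log_lt_logRatio (hN : 1 ≤ N) (ha : a ∈ Ioo (aMin N) (aStar N)) :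
    Real.log ((2 * (N : ℝ) + 1) * a) < logRatio N a := by
  have ha' := mem_Ioo_one hN ha
  have hNp : (0 : ℝ) < N := by exact_mod_cast hN
  have h0 := pos_of_mem ha'
  have h1 := mul_sub_one_pos ha'
  have h2 := Real.log_lt_log (by positivity) (mul_sub_one_lt ha.2)
  rw [Real.log_mul (by positivity) h1.ne'] at h2
  rw [logRatio, Real.log_mul (by positivity) h0.ne', Real.log_mul hNp.ne' h0.ne']
  linarith

theorem phi_mem (hN : 1 ≤ N) (ha : a ∈ Ioo (aMin N) (aStar N)) : phi N a ∈ Ioo (0 : ℝ) 1 := by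
  have ha' := mem_Ioo_one hN ha
  exact ⟨div_pos (log_expansion_pos hN ha') (logRatio_pos hN ha'),
    (div_lt_one (logRatio_pos hN ha')).2 (log_lt_logRatio hN ha)⟩

/-- The logarithm of the equation defining the threshold. -/
theorem threshold_eq (hN : 1 ≤ N) (ha : a ∈ Ioo (aMin N) 1) :
    (2 * (N : ℝ) + 1) * Real.log ((2 * (N : ℝ) + 1) * a) - N * logRatio N a =
      Real.log ((2 * (N : ℝ) + 1) ^ (2 * N + 1) * a ^ (N + 1) * (((N : ℝ) + 1) * a - 1) ^ N) -
        Real.log ((N : ℝ) ^ N) := by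
  have hNp : (0 : ℝ) < N := by exact_mod_cast hN
  have h0 := pos_of_mem ha
  have h1 := mul_sub_one_pos ha
  rw [logRatio, Real.log_mul (by positivity) h0.ne', Real.log_mul hNp.ne' h0.ne',
    Real.log_mul (by positivity) (by positivity), Real.log_mul (by positivity) (by positivity),
    Real.log_pow, Real.log_pow, Real.log_pow, Real.log_pow]
  push_cast
  ring

theorem aTilde_mem_one (hN : 1 ≤ N) : aTilde N ∈ Ioo (aMin N) 1 := (aTilde_spec hN).1.1

theorem threshold_aTilde (hN : 1 ≤ N) :
    (2 * (N : ℝ) + 1) * Real.log ((2 * (N : ℝ) + 1) * aTilde N) - N * logRatio N (aTilde N) = 0 := by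
  rw [threshold_eq hN (aTilde_mem_one hN), (aTilde_spec hN).1.2, sub_self]

theorem threshold_mono (hN : 1 ≤ N) {a' : ℝ} (ha : a ∈ Ioo (aMin N) 1)
    (ha' : a' ∈ Ioo (aMin N) 1) (h : a ≤ a') :
    (2 * (N : ℝ) + 1) * Real.log ((2 * (N : ℝ) + 1) * a) - N * logRatio N a ≤
      (2 * (N : ℝ) + 1) * Real.log ((2 * (N : ℝ) + 1) * a') - N * logRatio N a' := by
  have hNp : (0 : ℝ) < N := by exact_mod_cast hN
  have h0 := pos_of_mem ha
  have h1 := mul_sub_one_pos ha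
  have h2 := pos_of_mem ha'
  rw [threshold_eq hN ha, threshold_eq hN ha']
  gcongr

theorem aTilde_mem (hN : 1 ≤ N) : aTilde N ∈ Ioo (aMin N) (aStar N) := by
  have hm := aTilde_mem_one hN
  refine ⟨hm.1, ?_⟩
  by_contra! hle
  have hNp : (0 : ℝ) < N := by exact_mod_cast hN
  have h0 := pos_of_mem hm
  have h1 := mul_sub_one_pos hm
  have h2 : (N : ℝ) ≤ (2 * (N : ℝ) + 1) * (((N : ℝ) + 1) * aTilde N - 1) := by
    unfold aStar at hle
    rw [div_le_iff₀ (by positivity)] at hle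
    linarith
  have h3 := Real.log_le_log hNp h2
  rw [Real.log_mul (by positivity) h1.ne'] at h3
  have h4 := log_expansion_pos hN hm
  have h5 := threshold_aTilde hN
  rw [logRatio, Real.log_mul hNp.ne' h0.ne'] at h5
  have h6 := Real.log_mul (x := 2 * (N : ℝ) + 1) (by positivity) h0.ne'
  rw [h6] at h4 h5
  nlinarith

theorem le_phi (hN : 1 ≤ N) (ha : a ∈ Ioo (aMin N) 1) (h : aTilde N ≤ a) :
    (N : ℝ) / (2 * (N : ℝ) + 1) ≤ phi N a := by
  have h1 := threshold_mono hN (aTilde_mem_one hN) ha h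
  rw [threshold_aTilde hN, ← phi_mul_logRatio hN ha] at h1
  rw [div_le_iff₀ (by positivity)]
  refine le_of_mul_le_mul_right ?_ (logRatio_pos hN ha)
  linarith

theorem phi_le (hN : 1 ≤ N) (ha : a ∈ Ioo (aMin N) 1) (h : a ≤ aTilde N) :
    phi N a ≤ (N : ℝ) / (2 * (N : ℝ) + 1) := by
  have h1 := threshold_mono hN ha (aTilde_mem_one hN) h
  rw [threshold_aTilde hN, ← phi_mul_logRatio hN ha] at h1
  rw [le_div_iff₀ (by positivity)]
  refine le_of_mul_le_mul_right ?_ (logRatio_pos hN ha)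
  linarith

theorem one_le_tilt (hN : 1 ≤ N) {p : ℝ} (hp : p < 1) (h : (N : ℝ) / (2 * (N : ℝ) + 1) ≤ p) :
    1 ≤ tilt N p := by
  have hNp : (0 : ℝ) < N := by exact_mod_cast hN
  rw [div_le_iff₀ (by positivity)] at h
  unfold tilt
  rw [one_le_div (mul_pos hNp (by linarith))]
  linarith

theorem tilt_le_one (hN : 1 ≤ N) {p : ℝ} (hp : p < 1) (h : p ≤ (N : ℝ) / (2 * (N : ℝ) + 1)) :
    tilt N p ≤ 1 := by
  have hNp : (0 : ℝ) < N := by exact_mod_cast hN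
  rw [le_div_iff₀ (by positivity)] at h
  unfold tilt
  rw [div_le_one (mul_pos hNp (by linarith))]
  linarith

/-! ### Slopes and frequencies of odd digits -/

theorem chordSlope_eq_exp (hN : 1 ≤ N) (ha : a ∈ Ioo (aMin N) 1) (n : ℕ) (x : ℝ) :
    chordSlope N a n x = Real.exp ((phi N a * n - oddCount N n x) * logRatio N a) := by
  have h0 := pos_of_mem ha
  have h1 : 0 < bParam N a / a := div_pos (bParam_pos hN ha) h0
  rw [sub_mul, mul_right_comm, phi_mul_logRatio hN ha, logRatio_eq hN ha, chordSlope,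
    ← Real.rpow_natCast, ← Real.rpow_natCast, Real.rpow_def_of_pos (by positivity),
    Real.rpow_def_of_pos h1, ← Real.exp_add]
  congr 1; ring

/-- If the frequency of odd digits stays above some `q > phi N a`, the slopes decay
exponentially. -/
theorem tendsto_chordSlope_of_le (hN : 1 ≤ N) (ha : a ∈ Ioo (aMin N) 1) {x q C : ℝ}
    (hq : phi N a < q) (hx : ∀ᶠ n : ℕ in atTop, q * n - C ≤ oddCount N n x) :
    Tendsto (fun n => chordSlope N a n x) atTop (𝓝 0) := by
  have hD := logRatio_pos hN ha
  have hθ : Real.exp (-((q - phi N a) * logRatio N a)) < 1 := by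
    rw [Real.exp_lt_one_iff, neg_neg_iff_pos]
    exact mul_pos (sub_pos.2 hq) hD
  have hlim := (tendsto_pow_atTop_nhds_zero_of_lt_one (Real.exp_pos _).le hθ).const_mul
    (Real.exp (C * logRatio N a))
  rw [mul_zero] at hlim
  refine squeeze_zero' (Eventually.of_forall fun n => ?_) ?_ hlim
  · rw [chordSlope_eq_exp hN ha]; positivity
  · filter_upwards [hx] with n hn
    rw [chordSlope_eq_exp hN ha, ← Real.exp_nat_mul, ← Real.exp_add, Real.exp_le_exp]
    nlinarith

theorem oddCount_mono (hN : 1 ≤ N) (x : ℝ) : Monotone fun n => oddCount N n x := by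
  refine monotone_nat_of_le_succ fun n => ?_
  have h1 := floor_mul_pow_succ_div (m := 2 * N + 1) (by omega) x n
  push_cast at h1
  have h2 := oddDigits_mul_add hN (⌊x * (2 * (N : ℝ) + 1) ^ (n + 1)⌋₊ / (2 * N + 1))
    (Nat.mod_lt ⌊x * (2 * (N : ℝ) + 1) ^ (n + 1)⌋₊ (by omega : 0 < 2 * N + 1))
  rw [Nat.div_add_mod, h1] at h2
  simp only [oddCount]
  omega

/-! ### The dimension of the zero set and of its complement -/

/-- A set containing, for all large `K`, the numbers with `j K` odd digits in every block of `K`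
digits has at least the dimension `h N p`, where `p` is the limit of `j K / K`. -/
theorem le_dimH_of_blocks (hN : 1 ≤ N) {p : ℝ} (hp : p ∈ Ioo (0 : ℝ) 1) {S : Set ℝ} (j : ℕ → ℕ)
    (hj : Tendsto (fun K => (j K : ℝ) / K) atTop (𝓝 p))
    (hS : ∀ᶠ K in atTop, ∀ x ∈ Ioo (0 : ℝ) 1, (∀ n, oddCount N (K * n) x = n * j K) → x ∈ S) :
    ENNReal.ofReal (h N p) ≤ dimH S := by
  have hlog : Tendsto (fun K : ℕ => Real.log ((K : ℝ) + 1) / K / Real.log (2 * (N : ℝ) + 1))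
      atTop (𝓝 0) := by
    have h1 := (Real.tendsto_pow_log_div_mul_add_atTop 1 (-1) 1 one_ne_zero).comp
      ((tendsto_natCast_atTop_atTop (R := ℝ)).atTop_add (tendsto_const_nhds (x := (1 : ℝ))))
    simpa [Function.comp_def] using h1.div_const (Real.log (2 * (N : ℝ) + 1))
  have hlim : Tendsto (fun K : ℕ => ENNReal.ofReal (h N ((j K : ℝ) / K) -
      Real.log ((K : ℝ) + 1) / K / Real.log (2 * (N : ℝ) + 1))) atTop
      (𝓝 (ENNReal.ofReal (h N p))) := by
    have := (((continuous_h hN).tendsto p).comp hj).sub hlog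
    rw [sub_zero] at this
    exact ENNReal.tendsto_ofReal this
  refine le_of_tendsto hlim ?_
  filter_upwards [hS, hj.eventually (Ioo_mem_nhds hp.1 hp.2), eventually_gt_atTop 0]
    with K hK hjK hK0
  have hK0' : (0 : ℝ) < K := by exact_mod_cast hK0
  have hj0 : 0 < j K := by
    have h1 := hjK.1
    rw [lt_div_iff₀ hK0', zero_mul] at h1
    exact_mod_cast h1
  have hj1 : j K < K := by
    have h1 := hjK.2
    rw [div_lt_one hK0'] at h1
    exact_mod_cast h1
  refine (ENNReal.ofReal_le_ofReal (entropy_le_log_choose hN hj0 hj1)).trans ?_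
  exact (le_dimH_blocks hN hj0 hj1.le).trans (dimH_mono fun x hx => hK x hx.1 hx.2)

theorem dimH_zeroDerivSet (hN : 1 ≤ N) (ha : aTilde N ≤ a) (ha' : a < aStar N) :
    dimH (zeroDerivSet N a) = ENNReal.ofReal (h N (phi N a)) := by
  have hm : a ∈ Ioo (aMin N) (aStar N) := ⟨(aTilde_mem hN).1.trans_le ha, ha'⟩
  have hm1 := mem_Ioo_one hN hm
  have hp := phi_mem hN hm
  have hD := logRatio_pos hN hm1
  apply le_antisymm
  · let A : ℕ → Finset ℕ := fun n =>
      (Finset.range ((2 * N + 1) ^ n)).filter fun k => phi N a * n ≤ oddDigits N k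
    refine (dimH_mono ?_).trans (dimH_limsup_le hN A (d := h N (phi N a)) fun n => ?_)
    · intro x hx
      obtain ⟨hx01, hx0⟩ := (mem_zeroDerivSet_iff hN hm1).1 hx
      refine ⟨hx01, Eventually.frequently ?_⟩
      filter_upwards [hx0.eventually (gt_mem_nhds one_pos)] with n hn
      rw [chordSlope_eq_exp hN hm1, Real.exp_lt_one_iff] at hn
      refine Finset.mem_filter.2 ⟨Finset.mem_range.2 (floor_lt_pow N n hx01), ?_⟩
      have h1 := neg_of_mul_neg_left hn hD.le
      rw [oddCount] at h1
      linarith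
    · have h1 := card_le_rpow hN hp (phi N a) n (A n) fun k hk => by
        obtain ⟨h1, h2⟩ := Finset.mem_filter.1 hk
        refine ⟨Finset.mem_range.1 h1, ?_⟩
        rw [← Real.rpow_natCast]
        exact Real.rpow_le_rpow_of_exponent_le
          (one_le_tilt hN hp.2 (le_phi hN hm1 ha)) h2
      simpa using h1
  · refine le_dimH_of_blocks hN hp (fun K => ⌊phi N a * K⌋₊ + 1) ?_ ?_
    · have h1 := (tendsto_nat_floor_mul_div_atTop hp.1.le).comp
        (tendsto_natCast_atTop_atTop (R := ℝ))
      have h2 := h1.add (tendsto_one_div_atTop_nhds_zero_nat (𝕜 := ℝ))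
      rw [add_zero] at h2
      refine h2.congr fun K => ?_
      simp only [Function.comp]; push_cast; ring
    · filter_upwards [eventually_gt_atTop 0] with K hK x hx hcount
      have hK' : (0 : ℝ) < K := by exact_mod_cast hK
      refine (mem_zeroDerivSet_iff hN hm1).2 ⟨hx, ?_⟩
      set j := ⌊phi N a * K⌋₊ + 1 with hj
      have hjK : phi N a < (j : ℝ) / K := by
        rw [lt_div_iff₀ hK', hj]
        push_cast
        exact Nat.lt_floor_add_one _
      -- at most one incomplete block is lost, hence `C = j`
      refine tendsto_chordSlope_of_le hN hm1 (C := j) hjK (Eventually.of_forall fun n => ?_)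
      have h1 := oddCount_mono hN x (Nat.mul_div_le n K)
      simp only [hcount] at h1
      have h2 : ((n / K * j : ℕ) : ℝ) ≤ oddCount N n x := by exact_mod_cast h1
      have h3 : (n : ℝ) ≤ K * ((n / K : ℕ) + 1 : ℝ) := by
        exact_mod_cast (Nat.lt_mul_div_succ n hK).le
      push_cast at h2
      refine le_trans ?_ h2
      have h4 : (n : ℝ) / K ≤ ((n / K : ℕ) : ℝ) + 1 := by rwa [div_le_iff₀' hK']
      have h5 : (0 : ℝ) ≤ j := j.cast_nonneg
      calc (j : ℝ) / K * n - j = (n / K - 1) * j := by ring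
        _ ≤ ((n / K : ℕ) : ℝ) * j := by gcongr; linarith

theorem dimH_compl_zeroDerivSet (hN : 1 ≤ N) (ha : aMin N < a) (ha' : a ≤ aTilde N) :
    dimH (Ioo (0 : ℝ) 1 \ zeroDerivSet N a) = ENNReal.ofReal (h N (phi N a)) := by
  have hm : a ∈ Ioo (aMin N) (aStar N) := ⟨ha, ha'.trans_lt (aTilde_mem hN).2⟩
  have hm1 := mem_Ioo_one hN hm
  have hp := phi_mem hN hm
  have hD := logRatio_pos hN hm1
  apply le_antisymm
  -- the critical frequency itself is not enough to make the slopes decay, so let `q` decrease to it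
  · have hlim : Tendsto (fun q : ℝ => ENNReal.ofReal (h N (phi N a) +
        (phi N a - q) * Real.log (tilt N (phi N a)) / Real.log (2 * (N : ℝ) + 1)))
        (𝓝[>] (phi N a)) (𝓝 (ENNReal.ofReal (h N (phi N a)))) := by
      have hc : Continuous fun q : ℝ => ENNReal.ofReal (h N (phi N a) +
          (phi N a - q) * Real.log (tilt N (phi N a)) / Real.log (2 * (N : ℝ) + 1)) :=
        ENNReal.continuous_ofReal.comp (by fun_prop)
      have := hc.tendsto (phi N a)
      simp only [sub_self, zero_mul, zero_div, add_zero] at this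
      exact this.mono_left nhdsWithin_le_nhds
    refine ge_of_tendsto hlim ?_
    filter_upwards [self_mem_nhdsWithin] with q hq
    let A : ℕ → Finset ℕ := fun n =>
      (Finset.range ((2 * N + 1) ^ n)).filter fun k => (oddDigits N k : ℝ) ≤ q * n
    refine (dimH_mono ?_).trans (dimH_limsup_le hN A fun n =>
      card_le_rpow hN hp q n (A n) fun k hk => ?_)
    · intro x hx
      refine ⟨hx.1, fun hev => hx.2 ((mem_zeroDerivSet_iff hN hm1).2 ⟨hx.1, ?_⟩)⟩
      refine tendsto_chordSlope_of_le hN hm1 (C := 0) hq ?_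
      filter_upwards [hev] with n hn
      by_contra! hlt
      refine hn (Finset.mem_filter.2 ⟨Finset.mem_range.2 (floor_lt_pow N n hx.1), ?_⟩)
      rw [oddCount] at hlt
      linarith
    · obtain ⟨h1, h2⟩ := Finset.mem_filter.1 hk
      refine ⟨Finset.mem_range.1 h1, ?_⟩
      rw [← Real.rpow_natCast (tilt N (phi N a)) (oddDigits N k)]
      exact Real.rpow_le_rpow_of_exponent_ge (tilt_pos hN hp)
        (tilt_le_one hN hp.2 (phi_le hN hm1 ha')) h2
  · refine le_dimH_of_blocks hN hp (fun K => ⌊phi N a * K⌋₊) ?_ ?_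
    · exact (tendsto_nat_floor_mul_div_atTop hp.1.le).comp (tendsto_natCast_atTop_atTop (R := ℝ))
    · filter_upwards [eventually_gt_atTop 0] with K hK x hx hcount
      -- with at most `phi N a * K` odd digits per block, the slopes at multiples of `K` are at
      -- least 1
      refine ⟨hx, fun hz => ?_⟩
      have h0 := ((mem_zeroDerivSet_iff hN hm1).1 hz).2
      have hsub : Tendsto (fun n : ℕ => K * n) atTop atTop :=
        tendsto_id.const_mul_atTop' hK
      obtain ⟨n, hn⟩ := ((h0.comp hsub).eventually (gt_mem_nhds one_pos)).exists
      simp only [Function.comp] at hn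
      rw [chordSlope_eq_exp hN hm1, hcount, Real.exp_lt_one_iff] at hn
      have h1 := neg_of_mul_neg_left hn hD.le
      have h2 : (⌊phi N a * K⌋₊ : ℝ) ≤ phi N a * K :=
        Nat.floor_le (mul_nonneg hp.1.le K.cast_nonneg)
      push_cast at h1
      have h3 : (0 : ℝ) ≤ n := n.cast_nonneg
      nlinarith

end CriticalFrequency

/-! ### Concavity of the dimension -/

section Concavity

variable {N : ℕ} {a : ℝ}

/-- The inequality to which `(h ∘ phi)'' ≤ 0` reduces, to the left of the threshold. Here `p = phi`,
`D = log (a/b)`, `A = 1/a`, `B = b'/b`, and `Λ` is the logarithm of the tilt. -/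
theorem second_deriv_bound_left {A B p D Λ : ℝ} (hp0 : 0 < p) (hp1 : p < 1) (hΛ : Λ ≤ 0)
    (hΛD : -Λ ≤ D) :
    0 ≤ (A * (1 - p) + p * B) ^ 2 + p * (1 - p) * (Λ * (2 * (A * (1 - p) + p * B) * (B - A) -
      D * (A ^ 2 * (1 - p) + p * B ^ 2))) := by
  have hv : 0 < p * (1 - p) := mul_pos hp0 (by linarith)
  set M := A * (1 - p) + p * B with hM
  have e : A ^ 2 * (1 - p) + p * B ^ 2 = M ^ 2 + p * (1 - p) * (B - A) ^ 2 := by rw [hM]; ring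
  rw [e]
  set v := p * (1 - p)
  set X := 2 * M * (B - A) - D * (M ^ 2 + v * (B - A) ^ 2) with hX
  rcases le_total X 0 with h | h
  · have := mul_nonneg hv.le (mul_nonneg_of_nonpos_of_nonpos hΛ h)
    positivity
  -- the worst case `Λ = -D` is a sum of squares
  · have h1 : -D * X ≤ Λ * X := mul_le_mul_of_nonneg_right (by linarith) h
    have h2 : M ^ 2 + v * (-D * X) = (M - D * v * (B - A)) ^ 2 + D ^ 2 * v * M ^ 2 := by
      rw [hX]; ring
    have h3 : 0 ≤ (M - D * v * (B - A)) ^ 2 + D ^ 2 * v * M ^ 2 := by positivity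
    have h4 := mul_le_mul_of_nonneg_left h1 hv.le
    linarith

/-- The same inequality to the right of the threshold, with `c = (N+1)/N`. -/
theorem second_deriv_bound_right {A B p D Λ c : ℝ} (hp0 : 0 < p) (hp1 : p < 1) (hA : 0 < A)
    (hΛ : 0 ≤ Λ) (hc : 0 ≤ c) (hΛc : p * (1 - p) * Λ ≤ c) (hD : D ≤ 2) (hB : 2 * c * A ≤ B) :
    0 ≤ (A * (1 - p) + p * B) ^ 2 + p * (1 - p) * (Λ * (2 * (A * (1 - p) + p * B) * (B - A) -
      D * (A ^ 2 * (1 - p) + p * B ^ 2))) := by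
  have hp1' : 0 < 1 - p := by linarith
  have hv : 0 < p * (1 - p) := mul_pos hp0 hp1'
  set M := A * (1 - p) + p * B with hM
  set X := 2 * M * (B - A) - D * (A ^ 2 * (1 - p) + p * B ^ 2) with hX
  rcases le_total 0 X with h | h
  · positivity
  · have h1 : c * X ≤ p * (1 - p) * Λ * X := mul_le_mul_of_nonpos_right hΛc h
    have h2 : 2 * M * (B - A) - 2 * (A ^ 2 * (1 - p) + p * B ^ 2) ≤ X := by
      rw [hX]
      have : 0 ≤ A ^ 2 * (1 - p) + p * B ^ 2 := by positivity
      nlinarith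
    have h3 := mul_le_mul_of_nonneg_left h2 hc
    have h4 : 2 * c * A * (2 * c * A) ≤ 2 * c * A * B :=
      mul_le_mul_of_nonneg_left hB (by positivity)
    -- at `D = 2` the bound completes a square
    have h5 : M ^ 2 + c * (2 * M * (B - A) - 2 * (A ^ 2 * (1 - p) + p * B ^ 2)) =
        (M - 2 * c * A) ^ 2 + (2 * c * A * B - 2 * c * A * (2 * c * A)) := by
      rw [hM]; ring
    have h6 : 0 ≤ (M - 2 * c * A) ^ 2 := sq_nonneg _
    linarith

/-- To the right of the threshold the ratio `a / b` is at most `e²`. -/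
theorem logRatio_le_two (hN : 1 ≤ N) (ha : a ∈ Ioo (aMin N) 1)
    (h : (N : ℝ) / (2 * (N : ℝ) + 1) ≤ phi N a) : logRatio N a ≤ 2 := by
  -- Otherwise `(2N+1) a ≥ e^{2ν}` because `phi ≥ ν`, which contradicts `a / b ≥ e² ≥ 7`.
  by_contra! hD
  have hNp : (1 : ℝ) ≤ N := by exact_mod_cast hN
  have h0 := pos_of_mem ha
  have h1 := mul_sub_one_pos ha
  set ν : ℝ := (N : ℝ) / (2 * (N : ℝ) + 1) with hν
  have hν0 : 0 < ν := by positivity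
  have hP : 2 * ν ≤ Real.log ((2 * (N : ℝ) + 1) * a) := by
    rw [← phi_mul_logRatio hN ha]; nlinarith
  rw [Real.le_log_iff_exp_le (by positivity)] at hP
  have hx := (Real.quadratic_le_exp_of_nonneg (by positivity : 0 ≤ 2 * ν)).trans hP
  have he : (7 : ℝ) ≤ Real.exp 2 := by
    have h2 : Real.exp 2 = Real.exp 1 * Real.exp 1 := by rw [← Real.exp_add]; norm_num
    rw [h2]
    nlinarith [Real.exp_one_gt_d9]
  rw [logRatio, ← Real.log_div (by positivity) h1.ne',
    Real.lt_log_iff_exp_lt (by positivity)] at hD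
  have hq := he.trans hD.le
  rw [le_div_iff₀ h1] at hq
  have e1 : 1 + 2 * ν + (2 * ν) ^ 2 / 2 =
      (10 * (N : ℝ) ^ 2 + 6 * N + 1) / (2 * (N : ℝ) + 1) ^ 2 := by
    rw [hν]; field_simp; ring
  rw [e1, div_le_iff₀ (by positivity)] at hx
  have h3 : (6 * (N : ℝ) + 7) * a ≤ 7 := by linarith
  have h4 : (6 * (N : ℝ) + 7) * (10 * (N : ℝ) ^ 2 + 6 * N + 1) ≤
      7 * (2 * (N : ℝ) + 1) ^ 3 := by
    calc _ ≤ (6 * (N : ℝ) + 7) * ((2 * (N : ℝ) + 1) * a * (2 * (N : ℝ) + 1) ^ 2) := by gcongr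
      _ = ((6 * (N : ℝ) + 7) * a) * (2 * (N : ℝ) + 1) ^ 3 := by ring
      _ ≤ _ := by gcongr
  have h5 : 0 < (N : ℝ) ^ 3 := by positivity
  nlinarith

/-- The tilt at `phi` is at least `b / a`; this follows from `x log x ≥ x - 1`. -/
theorem neg_log_tilt_le (hN : 1 ≤ N) (ha : a ∈ Ioo (aMin N) (aStar N)) :
    -Real.log (tilt N (phi N a)) ≤ logRatio N a := by
  have ha1 := mem_Ioo_one hN ha
  have hNp : (0 : ℝ) < N := by exact_mod_cast hN
  have h0 := pos_of_mem ha1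
  have h1 := mul_sub_one_pos ha1
  have hp := phi_mem hN ha
  have hp1 : 0 < 1 - phi N a := by linarith [hp.2]
  have hD := logRatio_pos hN ha1
  have hPD := phi_mul_logRatio hN ha1
  rw [neg_le, logRatio, neg_sub, ← Real.log_div h1.ne' (by positivity)]
  refine Real.log_le_log (by positivity) ?_
  rw [tilt, div_le_div_iff₀ (by positivity) (by positivity)]
  have hr : (0 : ℝ) < 2 * (N : ℝ) + 1 := by positivity
  set x := (2 * (N : ℝ) + 1) * a with hx
  set y := (2 * (N : ℝ) + 1) * (((N : ℝ) + 1) * a - 1) / N with hy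
  have hx0 : 0 < x := by positivity
  have hy0 : 0 < y := by positivity
  have hmul : ∀ z : ℝ, 0 < z → z - 1 ≤ z * Real.log z := by
    intro z hz
    have h2 := mul_le_mul_of_nonneg_left (Real.one_sub_inv_le_log_of_pos hz) hz.le
    rwa [mul_sub, mul_one, mul_inv_cancel₀ hz.ne'] at h2
  have hx1 := mul_le_mul_of_nonneg_left (hmul x hx0) (by positivity : (0 : ℝ) ≤ (N : ℝ) + 1)
  have hy1 := mul_le_mul_of_nonneg_left (hmul y hy0) hNp.le
  have hNy : (N : ℝ) * y = ((N : ℝ) + 1) * x - (2 * (N : ℝ) + 1) := by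
    rw [hx, hy]; field_simp
  have hNy0 : 0 < (N : ℝ) * y := by positivity
  have hly : Real.log y = -((1 - phi N a) * logRatio N a) := by
    rw [sub_mul, hPD, one_mul, logRatio, hy, hx, Real.log_div (by positivity) hNp.ne',
      Real.log_mul hr.ne' h1.ne', Real.log_mul hr.ne' h0.ne', Real.log_mul hNp.ne' h0.ne']
    ring
  -- with weights `N + 1` and `N` the terms `x - 1` and `y - 1` add up to `2 N y ≥ 0`
  have hsum : 0 ≤ ((N : ℝ) + 1) * (x * (phi N a * logRatio N a)) +
      N * (y * -((1 - phi N a) * logRatio N a)) := by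
    rw [hPD, ← hly]; linarith
  have hfac : ((N : ℝ) + 1) * (x * (phi N a * logRatio N a)) +
      N * (y * -((1 - phi N a) * logRatio N a)) = (2 * (N : ℝ) + 1) * logRatio N a *
        (((N : ℝ) + 1) * a * phi N a - (((N : ℝ) + 1) * a - 1) * (1 - phi N a)) := by
    rw [hx, hy]; field_simp; ring
  rw [hfac] at hsum
  have h2 := nonneg_of_mul_nonneg_right hsum (by positivity)
  nlinarith

theorem hasDerivAt_logRatio (hN : 1 ≤ N) (ha : a ∈ Ioo (aMin N) 1) :
    HasDerivAt (logRatio N) (a⁻¹ - ((N : ℝ) + 1) / (((N : ℝ) + 1) * a - 1)) a := by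
  have hNp : (0 : ℝ) < N := by exact_mod_cast hN
  have h0 := pos_of_mem ha
  have h1 := mul_sub_one_pos ha
  have d1 := ((hasDerivAt_id a).const_mul (N : ℝ)).log (by simp only [id]; positivity)
  have d2 := (((hasDerivAt_id a).const_mul ((N : ℝ) + 1)).sub_const 1).log
    (by simp only [id]; exact h1.ne')
  refine (d1.sub d2).congr_deriv ?_
  simp only [id]
  field_simp

theorem hasDerivAt_log_mul (hN : 1 ≤ N) (ha : a ∈ Ioo (aMin N) 1) :
    HasDerivAt (fun a => Real.log ((2 * (N : ℝ) + 1) * a)) a⁻¹ a := by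
  have h0 := pos_of_mem ha
  have d1 := ((hasDerivAt_id a).const_mul (2 * (N : ℝ) + 1)).log (by simp only [id]; positivity)
  refine d1.congr_deriv ?_
  simp only [id]
  field_simp

/-- The derivative of `phi`. -/
noncomputable def phiDeriv (N : ℕ) (a : ℝ) : ℝ :=
  (a⁻¹ * logRatio N a - Real.log ((2 * (N : ℝ) + 1) * a) *
    (a⁻¹ - ((N : ℝ) + 1) / (((N : ℝ) + 1) * a - 1))) / logRatio N a ^ 2

theorem hasDerivAt_phi (hN : 1 ≤ N) (ha : a ∈ Ioo (aMin N) 1) :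
    HasDerivAt (phi N) (phiDeriv N a) a :=
  (hasDerivAt_log_mul hN ha).div (hasDerivAt_logRatio hN ha) (logRatio_pos hN ha).ne'

theorem phiDeriv_eq (hN : 1 ≤ N) (ha : a ∈ Ioo (aMin N) 1) :
    phiDeriv N a = (a⁻¹ * (1 - phi N a) +
      phi N a * (((N : ℝ) + 1) / (((N : ℝ) + 1) * a - 1))) / logRatio N a := by
  have hD := (logRatio_pos hN ha).ne'
  rw [phiDeriv, ← phi_mul_logRatio hN ha]
  generalize ((N : ℝ) + 1) / (((N : ℝ) + 1) * a - 1) = B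
  field_simp
  ring

theorem hasDerivAt_phiDeriv (hN : 1 ≤ N) (ha : a ∈ Ioo (aMin N) 1) :
    HasDerivAt (phiDeriv N) ((2 * (a⁻¹ * (1 - phi N a) +
        phi N a * (((N : ℝ) + 1) / (((N : ℝ) + 1) * a - 1))) *
        (((N : ℝ) + 1) / (((N : ℝ) + 1) * a - 1) - a⁻¹) -
      logRatio N a * (a⁻¹ ^ 2 * (1 - phi N a) +
        phi N a * (((N : ℝ) + 1) / (((N : ℝ) + 1) * a - 1)) ^ 2)) / logRatio N a ^ 2) a := by
  have h0 := (pos_of_mem ha).ne'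
  have h1 := (mul_sub_one_pos ha).ne'
  have hD := (logRatio_pos hN ha).ne'
  have dA := hasDerivAt_inv h0
  have dB := (hasDerivAt_const a ((N : ℝ) + 1)).div
    (((hasDerivAt_id a).const_mul ((N : ℝ) + 1)).sub_const 1) (by simp only [id]; exact h1)
  have d := ((dA.mul (hasDerivAt_logRatio hN ha)).sub
    ((hasDerivAt_log_mul hN ha).mul (dA.sub dB))).div ((hasDerivAt_logRatio hN ha).pow 2)
    (pow_ne_zero 2 hD)
  refine d.congr_deriv ?_
  simp only [id, Pi.mul_apply, Pi.sub_apply, Pi.div_apply, Pi.pow_apply,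
    ← phi_mul_logRatio hN ha]
  have eB : ∀ z : ℝ, (0 * z - ((N : ℝ) + 1) * (((N : ℝ) + 1) * 1)) /
      (((N : ℝ) + 1) * a - 1) ^ 2 = -(((N : ℝ) + 1) / (((N : ℝ) + 1) * a - 1)) ^ 2 := by
    intro z; field_simp; ring
  rw [eB]
  generalize ((N : ℝ) + 1) / (((N : ℝ) + 1) * a - 1) = B
  field_simp
  ring

theorem hasDerivAt_h (hN : 1 ≤ N) {p : ℝ} (hp : p ∈ Ioo (0 : ℝ) 1) :
    HasDerivAt (h N) (-Real.log (tilt N p) / Real.log (2 * (N : ℝ) + 1)) p := by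
  have hNp : (0 : ℝ) < N := by exact_mod_cast hN
  have h0 := hp.1
  have h1 : 0 < 1 - p := by linarith [hp.2]
  have hfun : h N = fun p => (Real.negMulLog p + p * Real.log N + Real.negMulLog (1 - p) +
      (1 - p) * Real.log ((N : ℝ) + 1)) / Real.log (2 * (N : ℝ) + 1) := funext (h_eq hN)
  have hs : HasDerivAt (fun p : ℝ => 1 - p) (-1) p := (hasDerivAt_id p).const_sub 1
  have d := ((((Real.hasDerivAt_negMulLog h0.ne').add
    ((hasDerivAt_id p).mul_const (Real.log N))).add
    ((Real.hasDerivAt_negMulLog h1.ne').comp p hs)).add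
    (hs.mul_const (Real.log ((N : ℝ) + 1)))).div_const (Real.log (2 * (N : ℝ) + 1))
  rw [hfun]
  refine d.congr_deriv ?_
  rw [tilt, Real.log_div (by positivity) (by positivity), Real.log_mul h0.ne' (by positivity),
    Real.log_mul hNp.ne' h1.ne']
  ring

theorem hasDerivAt_log_tilt (hN : 1 ≤ N) {p : ℝ} (hp : p ∈ Ioo (0 : ℝ) 1) :
    HasDerivAt (fun p => Real.log (tilt N p)) (1 / (p * (1 - p))) p := by
  have hNp : (0 : ℝ) < N := by exact_mod_cast hN
  have h0 := hp.1
  have h1 : 0 < 1 - p := by linarith [hp.2]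
  have hs : HasDerivAt (fun p : ℝ => 1 - p) (-1) p := (hasDerivAt_id p).const_sub 1
  have d := (((hasDerivAt_id p).mul_const ((N : ℝ) + 1)).div (hs.const_mul (N : ℝ))
    (by positivity)).log (by simp only [id, Pi.div_apply]; positivity)
  refine d.congr_deriv ?_
  simp only [id, Pi.div_apply]
  field_simp
  ring

theorem concaveOn_h_phi (hN : 1 ≤ N) :
    ConcaveOn ℝ (Ioo (aMin N) (aStar N)) (fun a => h N (phi N a)) := by
  have hL := log_pos_of_one_le hN
  have hNp : (1 : ℝ) ≤ N := by exact_mod_cast hN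
  have d1 : ∀ a ∈ Ioo (aMin N) (aStar N), HasDerivAt (fun a => h N (phi N a))
      (-Real.log (tilt N (phi N a)) / Real.log (2 * (N : ℝ) + 1) * phiDeriv N a) a :=
    fun a ha => (hasDerivAt_h hN (phi_mem hN ha)).comp a (hasDerivAt_phi hN (mem_Ioo_one hN ha))
  have d2 := fun a (ha : a ∈ Ioo (aMin N) (aStar N)) =>
    ((((hasDerivAt_log_tilt hN (phi_mem hN ha)).comp a
      (hasDerivAt_phi hN (mem_Ioo_one hN ha))).neg.div_const (Real.log (2 * (N : ℝ) + 1))).mul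
      (hasDerivAt_phiDeriv hN (mem_Ioo_one hN ha)))
  refine concaveOn_of_hasDerivWithinAt2_nonpos (convex_Ioo _ _)
    (fun a ha => (d1 a ha).continuousAt.continuousWithinAt)
    (fun a ha => (d1 a (interior_subset ha)).hasDerivWithinAt)
    (fun a ha => (d2 a (interior_subset ha)).hasDerivWithinAt) fun a ha => ?_
  have ha := interior_subset ha
  have ha1 := mem_Ioo_one hN ha
  have hp := phi_mem hN ha
  have hp1 : 0 < 1 - phi N a := by linarith [hp.2]
  have h0 := pos_of_mem ha1
  have h1 := mul_sub_one_pos ha1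
  have hD := logRatio_pos hN ha1
  have key : 0 ≤ (a⁻¹ * (1 - phi N a) +
      phi N a * (((N : ℝ) + 1) / (((N : ℝ) + 1) * a - 1))) ^ 2 +
      phi N a * (1 - phi N a) * (Real.log (tilt N (phi N a)) * (2 * (a⁻¹ * (1 - phi N a) +
        phi N a * (((N : ℝ) + 1) / (((N : ℝ) + 1) * a - 1))) *
        (((N : ℝ) + 1) / (((N : ℝ) + 1) * a - 1) - a⁻¹) -
      logRatio N a * (a⁻¹ ^ 2 * (1 - phi N a) +
        phi N a * (((N : ℝ) + 1) / (((N : ℝ) + 1) * a - 1)) ^ 2))) := by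
    rcases le_total a (aTilde N) with hle | hle
    · exact second_deriv_bound_left hp.1 hp.2 (Real.log_nonpos (tilt_pos hN hp).le
        (tilt_le_one hN hp.2 (phi_le hN ha1 hle))) (neg_log_tilt_le hN ha)
    · have hphi := le_phi hN ha1 hle
      refine second_deriv_bound_right (c := ((N : ℝ) + 1) / N) hp.1 hp.2 (inv_pos.2 h0)
        (Real.log_nonneg (one_le_tilt hN hp.2 hphi)) (by positivity) ?_
        (logRatio_le_two hN ha1 hphi) ?_
      · calc phi N a * (1 - phi N a) * Real.log (tilt N (phi N a))
            ≤ phi N a * (1 - phi N a) * (tilt N (phi N a) - 1) :=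
              mul_le_mul_of_nonneg_left (Real.log_le_sub_one_of_pos (tilt_pos hN hp))
                (mul_pos hp.1 hp1).le
          _ = phi N a * (phi N a * (((N : ℝ) + 1) / N) - (1 - phi N a)) := by
              rw [tilt]; field_simp
          _ ≤ 1 * (1 * (((N : ℝ) + 1) / N) - 0) := by
              have hc : 0 ≤ ((N : ℝ) + 1) / N := by positivity
              have h2 : phi N a * (((N : ℝ) + 1) / N) ≤ 1 * (((N : ℝ) + 1) / N) := by
                gcongr; exact hp.2.le
              have h3 : phi N a * (phi N a * (((N : ℝ) + 1) / N) - (1 - phi N a)) ≤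
                  phi N a * (1 * (((N : ℝ) + 1) / N)) :=
                mul_le_mul_of_nonneg_left (by linarith) hp.1.le
              linarith
          _ = _ := by ring
      -- `B ≥ 2 c A` says that `a / b ≥ 2`
      · have h2 : ((N : ℝ) + 2) * a ≤ 2 := by
          have h3 := ha.2
          unfold aStar at h3
          rw [lt_div_iff₀ (by positivity)] at h3
          nlinarith
        rw [← div_eq_mul_inv, div_le_div_iff₀ h0 h1]
        have : 2 * (((N : ℝ) + 1) / N) * (((N : ℝ) + 1) * a - 1) =
          ((N : ℝ) + 1) * ((2 * (((N : ℝ) + 1) * a - 1)) / N) := by ring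
        rw [this]
        gcongr
        rw [div_le_iff₀ (by positivity)]
        linarith
  rw [phiDeriv_eq hN ha1]
  generalize ((N : ℝ) + 1) / (((N : ℝ) + 1) * a - 1) = B at key ⊢
  have e : ∀ p D L Λ M X : ℝ, p ≠ 0 → 1 - p ≠ 0 → D ≠ 0 → L ≠ 0 →
      -(1 / (p * (1 - p)) * (M / D)) / L * (M / D) + -Λ / L * (X / D ^ 2) =
        -(M ^ 2 + p * (1 - p) * (Λ * X)) / (L * D ^ 2 * (p * (1 - p))) := by
    intro p D L Λ M X _ _ _ _
    field_simp
    ring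
  have hden : 0 ≤ Real.log (2 * (N : ℝ) + 1) * logRatio N a ^ 2 * (phi N a * (1 - phi N a)) := by
    have := hp.1; positivity
  refine le_trans (le_of_eq (e _ _ _ _ _ _ hp.1.ne' hp1.ne' hD.ne' hL.ne')) ?_
  exact div_nonpos_of_nonpos_of_nonneg (neg_nonpos.2 key) hden

end Concavity

/-! ### The maximum and the limits -/

section Values

variable {N : ℕ}

theorem h_phi_aTilde (hN : 1 ≤ N) : h N (phi N (aTilde N)) = 1 := by
  have hNp : (0 : ℝ) < N := by exact_mod_cast hN
  have hL := log_pos_of_one_le hN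
  have hm := aTilde_mem_one hN
  rw [le_antisymm (phi_le hN hm le_rfl) (le_phi hN hm le_rfl), h,
    show 1 - (N : ℝ) / (2 * (N : ℝ) + 1) = ((N : ℝ) + 1) / (2 * (N : ℝ) + 1) by field_simp; ring,
    show (N : ℝ) / (2 * (N : ℝ) + 1) / N = (2 * (N : ℝ) + 1)⁻¹ by field_simp,
    show ((N : ℝ) + 1) / (2 * (N : ℝ) + 1) / ((N : ℝ) + 1) = (2 * (N : ℝ) + 1)⁻¹ by field_simp,
    Real.log_inv]
  generalize Real.log (2 * (N : ℝ) + 1) = L at hL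
  field_simp
  ring

theorem h_le_one (hN : 1 ≤ N) {p : ℝ} (hp : p ∈ Ioo (0 : ℝ) 1) : h N p ≤ 1 := by
  have hNp : (0 : ℝ) < N := by exact_mod_cast hN
  have hL := log_pos_of_one_le hN
  have h0 := hp.1
  have h1 : 0 < 1 - p := by linarith [hp.2]
  have hr : (0 : ℝ) < 2 * (N : ℝ) + 1 := by positivity
  have g1 := mul_le_mul_of_nonneg_left (Real.log_le_sub_one_of_pos
    (show 0 < (N : ℝ) / (p * (2 * (N : ℝ) + 1)) by positivity)) h0.le
  have g2 := mul_le_mul_of_nonneg_left (Real.log_le_sub_one_of_pos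
    (show 0 < ((N : ℝ) + 1) / ((1 - p) * (2 * (N : ℝ) + 1)) by positivity)) h1.le
  rw [Real.log_div hNp.ne' (by positivity), Real.log_mul h0.ne' hr.ne'] at g1
  rw [Real.log_div (by positivity) (by positivity), Real.log_mul h1.ne' hr.ne'] at g2
  have e : p * ((N : ℝ) / (p * (2 * (N : ℝ) + 1)) - 1) +
      (1 - p) * (((N : ℝ) + 1) / ((1 - p) * (2 * (N : ℝ) + 1)) - 1) = 0 := by
    field_simp; ring
  rw [h_eq hN, div_le_one hL, Real.negMulLog, Real.negMulLog]
  linarith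

theorem tendsto_h_phi_aMin (hN : 1 ≤ N) :
    Tendsto (fun a => h N (phi N a)) (𝓝[>] (aMin N))
      (𝓝 (Real.log ((N : ℝ) + 1) / Real.log (2 * (N : ℝ) + 1))) := by
  have hNp : (0 : ℝ) < N := by exact_mod_cast hN
  have hm : 0 < aMin N := by unfold aMin; positivity
  have hz : ((N : ℝ) + 1) * aMin N - 1 = 0 := by unfold aMin; field_simp; ring
  have hr : (0 : ℝ) < 2 * (N : ℝ) + 1 := by positivity
  have t1 : Tendsto (fun a => Real.log ((2 * (N : ℝ) + 1) * a)) (𝓝[>] (aMin N))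
      (𝓝 (Real.log ((2 * (N : ℝ) + 1) * aMin N))) :=
    ((continuousAt_const.mul continuousAt_id).log (mul_pos hr hm).ne').tendsto.mono_left
      nhdsWithin_le_nhds
  have t2 : Tendsto (fun a => Real.log ((N : ℝ) * a)) (𝓝[>] (aMin N))
      (𝓝 (Real.log ((N : ℝ) * aMin N))) :=
    ((continuousAt_const.mul continuousAt_id).log (mul_pos hNp hm).ne').tendsto.mono_left
      nhdsWithin_le_nhds
  have t3 : Tendsto (fun a : ℝ => ((N : ℝ) + 1) * a - 1) (𝓝[>] (aMin N)) (𝓝[>] 0) := by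
    refine tendsto_nhdsWithin_iff.2 ⟨?_, ?_⟩
    · have hc : Continuous fun a : ℝ => ((N : ℝ) + 1) * a - 1 := by fun_prop
      have := hc.tendsto (aMin N)
      rw [hz] at this
      exact this.mono_left nhdsWithin_le_nhds
    · filter_upwards [self_mem_nhdsWithin] with a ha
      have : ((N : ℝ) + 1) * aMin N < ((N : ℝ) + 1) * a := by gcongr; exact ha
      exact mem_Ioi.2 (by linarith)
  have t4 := t2.add_atTop (tendsto_neg_atBot_atTop.comp (Real.tendsto_log_nhdsGT_zero.comp t3))
  have t5 : Tendsto (phi N) (𝓝[>] (aMin N)) (𝓝 0) := t1.div_atTop t4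
  have t6 := ((continuous_h hN).tendsto 0).comp t5
  rw [h_eq hN 0] at t6
  simpa [Function.comp_def] using t6

theorem tendsto_h_phi_aStar (hN : 1 ≤ N) :
    Tendsto (fun a => h N (phi N a)) (𝓝[<] (aStar N))
      (𝓝 (Real.log (N : ℝ) / Real.log (2 * (N : ℝ) + 1))) := by
  have hNp : (0 : ℝ) < N := by exact_mod_cast hN
  have hm : aStar N ∈ Ioo (aMin N) 1 :=
    ⟨(aTilde_mem hN).1.trans (aTilde_mem hN).2, aStar_lt_one hN⟩
  have h0 := pos_of_mem hm
  have hval : phi N (aStar N) = 1 := by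
    have e : (N : ℝ) * aStar N / (((N : ℝ) + 1) * aStar N - 1) = (2 * (N : ℝ) + 1) * aStar N := by
      have : ((N : ℝ) + 1) * aStar N - 1 = N / (2 * (N : ℝ) + 1) := by
        unfold aStar; field_simp; ring
      rw [this]; field_simp
    have hD := logRatio_pos hN hm
    rw [phi, ← e, Real.log_div (by positivity) (mul_sub_one_pos hm).ne']
    exact div_self hD.ne'
  have t := ((continuous_h hN).continuousAt.comp (hasDerivAt_phi hN hm).continuousAt).tendsto
  simp only [Function.comp, hval] at t
  rw [h_eq hN 1] at t
  simpa [Function.comp_def] using t.mono_left nhdsWithin_le_nhds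

end Values

end SelfAffine

theorem mainTheorem2 (N : ℕ) (hN : 1 ≤ N) :
    (∀ a : ℝ, SelfAffine.aTilde N ≤ a → a < SelfAffine.aStar N →
      dimH (SelfAffine.zeroDerivSet N a) =
        ENNReal.ofReal (SelfAffine.h N (SelfAffine.phi N a))) ∧
    (∀ a : ℝ, SelfAffine.aMin N < a → a ≤ SelfAffine.aTilde N →
      dimH (Set.Ioo (0 : ℝ) 1 \ SelfAffine.zeroDerivSet N a) =
        ENNReal.ofReal (SelfAffine.h N (SelfAffine.phi N a))) ∧
    (ConcaveOn ℝ (Set.Ioo (SelfAffine.aMin N) (SelfAffine.aStar N))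
        (fun a => SelfAffine.h N (SelfAffine.phi N a)) ∧
      SelfAffine.aTilde N ∈ Set.Ioo (SelfAffine.aMin N) (SelfAffine.aStar N) ∧
      SelfAffine.h N (SelfAffine.phi N (SelfAffine.aTilde N)) = 1 ∧
      IsMaxOn (fun a => SelfAffine.h N (SelfAffine.phi N a))
        (Set.Ioo (SelfAffine.aMin N) (SelfAffine.aStar N)) (SelfAffine.aTilde N) ∧
      Filter.Tendsto (fun a => SelfAffine.h N (SelfAffine.phi N a))
        (nhdsWithin (SelfAffine.aMin N) (Set.Ioi (SelfAffine.aMin N)))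
        (nhds (Real.log ((N : ℝ) + 1) / Real.log (2 * (N : ℝ) + 1))) ∧
      Filter.Tendsto (fun a => SelfAffine.h N (SelfAffine.phi N a))
        (nhdsWithin (SelfAffine.aStar N) (Set.Iio (SelfAffine.aStar N)))
        (nhds (Real.log (N : ℝ) / Real.log (2 * (N : ℝ) + 1)))) := by
  refine ⟨fun a => SelfAffine.dimH_zeroDerivSet hN,
    fun a => SelfAffine.dimH_compl_zeroDerivSet hN, SelfAffine.concaveOn_h_phi hN,
    SelfAffine.aTilde_mem hN, SelfAffine.h_phi_aTilde hN, fun a ha => ?_,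
    SelfAffine.tendsto_h_phi_aMin hN, SelfAffine.tendsto_h_phi_aStar hN⟩
  exact (SelfAffine.h_le_one hN (SelfAffine.phi_mem hN ha)).trans_eq
    (SelfAffine.h_phi_aTilde hN).symm
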